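/- Let $d\in\mathbb N$, $\gamma>1$ and $\lambda_1,\dots,\lambda_d>0$. Let $\{Z^{(i)}_j : 1\le i\le d,\ j\ge 1\}$ be independent random variables such that, for each $i$, the $Z^{(i)}_1,Z^{(i)}_2,\dots$ are identically distributed, non-negative almost surely, and $$\mathbf P(Z^{(i)}_1>x)=\exp(-r_i(\log x))\quad\text{for all sufficiently large }x,$$ where $r_i$ is regularly varying at infinity with index $\gamma$, $r_i(y)/y^\gamma\to\lambda_i$ as $y\to\infty$, and $r_i(y+h)-r_i(y)\to\infty$ as $y\to\infty$ for every $h>0$ (the tail is rapidly varying). For instance $\mathbf P(Z^{(i)}_1>x)=c_i x^{\beta_i}e^{-\lambda_i(\log x)^\gamma}$ for large $x$ is allowed, and so is a lognormal law (with $\gamma=2$). Let $\mathbb D$ be the space of real-valued càdlàg functions on $[0,1]$ with the Skorokhod metric $d_{J_1}(\xi,\zeta)=\inf_{l}\max\big(\sup_t|l(t)-t|,\ \sup_t|\xi(l(t))-\zeta(t)|\big)$, $l$ running through the nondecreasing homeomorphisms of $[0,1]$. Equip $\mathbb D^d$ with the metric $\sum_{i=1}^d d_{J_1}$ and its Borel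 $\sigma$-algebra. Put $\bar S_n=(\bar S_n^{(1)},\dots,\bar S_n^{(d)})$ with $$\bar S^{(i)}_n(t)=\frac1n\sum_{j=1}^{\lfloor nt\rfloor}\big(Z^{(i)}_j-\mathbf E Z^{(i)}_1\big),\qquad t\in[0,1].$$ Let $\tilde{\mathbb D}_{<\infty}\subset\mathbb D$ be the set of nondecreasing pure jump functions $\xi$ with $\xi(0)=0$ and finitely many jumps (a jump at time $1$ is allowed), and let $$\tilde I^d(\xi_1,\dots,\xi_d)=\begin{cases}\sum_{i=1}^d\lambda_i\cdot\#\{t\in[0,1]:\xi_i(t)\ne\xi_i(t-)\}&\text{if }\xi_i\in\tilde{\mathbb D}_{<\infty}\text{ for all }i,\\ \infty&\text{otherwise.}\end{cases}$$ Theorem. Each $\bar S_n$ is a random element of $\mathbb D^d$, and $\{\bar S_n\}_{n\ge1}$ satisfies the extended large deviation principle on $(\mathbb D^d,\sum_i d_{J_1})$ with speed $\log^\gamma n$ and rate function $\tilde I^d$. That is, $\log^\gamma n\to\infty$, $\tilde I^d$ is lower semicontinuous, and for every open $G$ and every closed $F$ in $\mathbb D^d$, $$-\inf_{\xi\in G}\tilde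 I^d(\xi)\le\liminf_{n\to\infty}\frac{\log\mathbf P(\bar S_n\in G)}{\log^\gamma n},\qquad \limsup_{n\to\infty}\frac{\log\mathbf P(\bar S_n\in F)}{\log^\gamma n}\le-\lim_{\varepsilon\downarrow0}\ \inf_{\xi\in F^{\varepsilon}}\tilde I^d(\xi),$$ where $F^\varepsilon=\{\xi : d(\xi,F)\le\varepsilon\}$, $d$ being the metric of $\mathbb D^d$. -/

import Mathlib

open Set Filter Topology MeasureTheory ProbabilityTheory
open scoped ENNReal unitInterval

noncomputable section

/-! ### The Skorokhod space on the unit interval and the `J₁` metric -/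

/-- The Skorokhod space `𝔻 = 𝔻[0,1]` of real-valued càdlàg functions on `[0,1]`. -/
structure SkorokhodSpace where
  /-- the underlying function -/
  toFun : I → ℝ
  rightCont : ∀ t, ContinuousWithinAt toFun (Ici t) t
  exists_leftLim : ∀ t, ∃ l, Tendsto toFun (𝓝[<] t) (𝓝 l)

namespace SkorokhodSpace

instance : CoeFun SkorokhodSpace (fun _ => I → ℝ) := ⟨toFun⟩

/-- The `J₁` distance
`inf_{l} max (sup_t |l t - t|) (sup_t |ξ (l t) - ζ t|)`, where `l` runs through the nondecreasing
homeomorphisms of `[0,1]`, which are exactly the order automorphisms of `[0,1]`. The infimum and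
the suprema are computed in `[0,∞]`. -/
def distJ1 (ξ ζ : SkorokhodSpace) : ℝ≥0∞ :=
  ⨅ l : I ≃o I, max (⨆ t : I, edist (l t) t) (⨆ t : I, edist (ξ (l t)) (ζ t))

theorem distJ1_self (ξ : SkorokhodSpace) : distJ1 ξ ξ = 0 := by
  refine le_antisymm (iInf_le_of_le (OrderIso.refl I) ?_) bot_le
  simp

theorem distJ1_le_swap (ξ ζ : SkorokhodSpace) : distJ1 ξ ζ ≤ distJ1 ζ ξ := by
  refine le_iInf fun l => iInf_le_of_le l.symm (max_le_max ?_ ?_)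
  · refine iSup_le fun t => ?_
    refine le_trans ?_ (le_iSup (fun t : I => edist (l t) t) (l.symm t))
    simp [edist_comm]
  · refine iSup_le fun t => ?_
    refine le_trans ?_ (le_iSup (fun t : I => edist (ζ (l t)) (ξ t)) (l.symm t))
    simp [edist_comm]

theorem distJ1_triangle (ξ ζ η : SkorokhodSpace) :
    distJ1 ξ η ≤ distJ1 ξ ζ + distJ1 ζ η := by
  refine ENNReal.le_iInf_add_iInf fun l m => iInf_le_of_le (m.trans l) (max_le ?_ ?_)
  · refine iSup_le fun t => ?_
    refine (edist_triangle (l (m t)) (m t) t).trans (add_le_add ?_ ?_)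
    · exact (le_iSup (fun t : I => edist (l t) t) (m t)).trans (le_max_left _ _)
    · exact (le_iSup (fun t : I => edist (m t) t) t).trans (le_max_left _ _)
  · refine iSup_le fun t => ?_
    refine (edist_triangle (ξ (l (m t))) (ζ (m t)) (η t)).trans (add_le_add ?_ ?_)
    · exact (le_iSup (fun t : I => edist (ξ (l t)) (ζ t)) (m t)).trans (le_max_right _ _)
    · exact (le_iSup (fun t : I => edist (ζ (m t)) (η t)) t).trans (le_max_right _ _)

/-- `𝔻` carries the `J₁` distance and the topology that it induces. -/
instance : PseudoEMetricSpace SkorokhodSpace where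
  edist := distJ1
  edist_self := distJ1_self
  edist_comm ξ ζ := le_antisymm (distJ1_le_swap ξ ζ) (distJ1_le_swap ζ ξ)
  edist_triangle := distJ1_triangle

/-- The left limit `ξ(t-)`, with the convention `ξ(0-) = 0`. -/
def leftLimit (ξ : SkorokhodSpace) (t : I) : ℝ :=
  if t = 0 then 0 else Function.leftLim ξ.toFun t

/-- The set of jump times of `ξ`. -/
def jumpTimes (ξ : SkorokhodSpace) : Set I := {t | ξ t ≠ ξ.leftLimit t}

/-- `ξ` is a pure jump function: each of its values is the sum of the jumps up to that time. -/
def IsPureJump (ξ : SkorokhodSpace) : Prop :=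
  ∀ t : I, HasSum (fun s : Iic t => ξ s - ξ.leftLimit s) (ξ t)

/-- `𝔻^↑`: the nondecreasing pure jump functions. -/
def monotonePureJump : Set SkorokhodSpace := {ξ | Monotone ξ.toFun ∧ ξ.IsPureJump}

/-- `𝔻̃_{= j}`: the nondecreasing pure jump functions that start at `0` and have `j` jumps;
a jump at time `1` is allowed. -/
def tildeEq (j : ℕ) : Set SkorokhodSpace :=
  {ξ | ξ ∈ monotonePureJump ∧ ξ 0 = 0 ∧ ξ.jumpTimes.encard = j}

/-- `𝔻̃_{< ∞}`. -/
def tildeFin : Set SkorokhodSpace := ⋃ j : ℕ, tildeEq j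

end SkorokhodSpace

/-- The `d`-fold product of `𝔻` with the distance `∑ i, d_{J₁}`. -/
def SkorokhodProd (d : ℕ) : Type := Fin d → SkorokhodSpace

instance (d : ℕ) : PseudoEMetricSpace (SkorokhodProd d) where
  edist ξ ζ := ∑ i, edist (ξ i) (ζ i)
  edist_self ξ := by simp
  edist_comm ξ ζ := by simp [edist_comm]
  edist_triangle ξ ζ η := by
    rw [← Finset.sum_add_distrib]
    exact Finset.sum_le_sum fun i _ => edist_triangle _ _ _

instance (d : ℕ) : MeasurableSpace (SkorokhodProd d) := borel _

instance (d : ℕ) : BorelSpace (SkorokhodProd d) := ⟨rfl⟩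

/-! ### The extended large deviation principle -/

/-- The sequence of measures `μ` satisfies the extended large deviation principle with speed `a`
and rate function `J`. In the upper bound `Metric.cthickening ε F` is the closed `ε`-fattening
`{x | d(x, F) ≤ ε}`, and the limit of `inf_{F^ε} J` as `ε ↓ 0` is written as a supremum over
`ε > 0`, the infimum being nonincreasing in `ε`. -/
structure ExtendedLDP {X : Type*} [PseudoEMetricSpace X] [MeasurableSpace X]
    (μ : ℕ → Measure X) (a : ℕ → ℝ) (J : X → ℝ≥0∞) : Prop where
  lowerSemicontinuous : LowerSemicontinuous J
  speed : Tendsto a atTop atTop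
  lower : ∀ G : Set X, IsOpen G →
    -(⨅ x ∈ G, (J x : EReal)) ≤
      liminf (fun n => ENNReal.log (μ n G) / ((a n : ℝ) : EReal)) atTop
  upper : ∀ F : Set X, IsClosed F →
    limsup (fun n => ENNReal.log (μ n F) / ((a n : ℝ) : EReal)) atTop ≤
      -(⨆ (ε : ℝ) (_ : 0 < ε), ⨅ x ∈ Metric.cthickening ε F, (J x : EReal))

/-! ### Lognormal-type tails -/

/-- `r` is regularly varying at infinity with index `γ`. -/
def IsRegularlyVarying (r : ℝ → ℝ) (γ : ℝ) : Prop :=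
  (∀ᶠ y in atTop, 0 < r y) ∧
    ∀ t : ℝ, 0 < t → Tendsto (fun y => r (t * y) / r y) atTop (𝓝 (t ^ γ))

/-- Lognormal-type law on `[0,∞)`: its tail is `exp (-r (log x))` with `r` regularly varying of
index `γ` and `r y ~ lam * y ^ γ`, and the tail is rapidly varying, that is
`r (y + h) - r y → ∞` for every `h > 0`. For example
`r y = lam * y ^ γ - β * y - log c`, that is the tail `c * x ^ β * exp (-lam * (log x) ^ γ)`. -/
structure IsLognormalType (ρ : Measure ℝ) (γ lam : ℝ) : Prop where
  nonneg : ∀ᵐ x ∂ρ, 0 ≤ x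
  tail : ∃ r : ℝ → ℝ,
    IsRegularlyVarying r γ ∧
    Tendsto (fun y => r y / y ^ γ) atTop (𝓝 lam) ∧
    (∀ h : ℝ, 0 < h → Tendsto (fun y => r (y + h) - r y) atTop atTop) ∧
    ∀ᶠ x in atTop, ρ (Ioi x) = ENNReal.ofReal (Real.exp (-r (Real.log x)))

/-! ### Scaled random walks -/

theorem eventually_floor_eq_right (n : ℕ) (t : I) :
    ∀ᶠ s : I in 𝓝[≥] t, ⌊(n : ℝ) * s⌋₊ = ⌊(n : ℝ) * t⌋₊ := by
  have hc : Continuous fun s : I => (n : ℝ) * s := by fun_prop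
  have h1 : ∀ᶠ s : I in 𝓝[≥] t, (n : ℝ) * s < ⌊(n : ℝ) * t⌋₊ + 1 :=
    nhdsWithin_le_nhds
      (hc.continuousAt.eventually (gt_mem_nhds (Nat.lt_floor_add_one ((n : ℝ) * t))))
  filter_upwards [h1, self_mem_nhdsWithin] with s hs hts
  have hts' : (t : ℝ) ≤ s := hts
  have h0 : (0 : ℝ) ≤ (n : ℝ) * s := mul_nonneg n.cast_nonneg s.2.1
  rw [Nat.floor_eq_iff h0]
  exact ⟨(Nat.floor_le (mul_nonneg n.cast_nonneg t.2.1)).trans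
    (mul_le_mul_of_nonneg_left hts' n.cast_nonneg), hs⟩

theorem exists_eventually_floor_eq_left (n : ℕ) (t : I) :
    ∃ k : ℕ, ∀ᶠ s : I in 𝓝[<] t, ⌊(n : ℝ) * s⌋₊ = k := by
  have hc : Continuous fun s : I => (n : ℝ) * s := by fun_prop
  rcases Nat.eq_zero_or_pos ⌈(n : ℝ) * t⌉₊ with h | h
  · refine ⟨0, ?_⟩
    filter_upwards [self_mem_nhdsWithin] with s hs
    have hs' : (s : ℝ) ≤ t := le_of_lt hs
    have : (n : ℝ) * t ≤ 0 := by simpa using h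
    exact Nat.floor_of_nonpos ((mul_le_mul_of_nonneg_left hs' n.cast_nonneg).trans this)
  · obtain ⟨k, hk⟩ := Nat.exists_eq_add_of_lt h
    refine ⟨k, ?_⟩
    have hk' : ⌈(n : ℝ) * t⌉₊ = k + 1 := by omega
    have hlt : (k : ℝ) < (n : ℝ) * t := Nat.lt_ceil.1 (by omega)
    have hle : (n : ℝ) * t ≤ k + 1 := by
      have := Nat.le_ceil ((n : ℝ) * t)
      rw [hk'] at this
      exact_mod_cast this
    have hn : (0 : ℝ) < n := by
      rcases Nat.eq_zero_or_pos n with rfl | hn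
      · simp at h
      · exact_mod_cast hn
    have h1 : ∀ᶠ s : I in 𝓝[<] t, (k : ℝ) < (n : ℝ) * s :=
      nhdsWithin_le_nhds (hc.continuousAt.eventually (lt_mem_nhds hlt))
    filter_upwards [h1, self_mem_nhdsWithin] with s hs hst
    have hst' : (s : ℝ) < t := hst
    rw [Nat.floor_eq_iff (mul_nonneg n.cast_nonneg s.2.1)]
    exact ⟨hs.le, lt_of_lt_of_le (mul_lt_mul_of_pos_left hst' hn) hle⟩

/-- The scaled path `t ↦ (1/n) * ∑_{j = 1}^{⌊n t⌋} z_j`; the increment `z_j` is `z (j - 1)`. -/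
def scaledPath (n : ℕ) (z : ℕ → ℝ) : SkorokhodSpace where
  toFun t := (1 / (n : ℝ)) * ∑ j ∈ Finset.range ⌊(n : ℝ) * t⌋₊, z j
  rightCont t := by
    refine Tendsto.congr' ?_ tendsto_const_nhds
    filter_upwards [eventually_floor_eq_right n t] with s hs
    rw [hs]
  exists_leftLim t := by
    obtain ⟨k, hk⟩ := exists_eventually_floor_eq_left n t
    refine ⟨(1 / (n : ℝ)) * ∑ j ∈ Finset.range k, z j, Tendsto.congr' ?_ tendsto_const_nhds⟩
    filter_upwards [hk] with s hs
    rw [hs]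

/-- The vector of scaled and centered random walks, whose `i`-th coordinate at time `t` is
`(1/n) * ∑_{j = 1}^{⌊n t⌋} (Z i j - E[Z i 1])`; the increments are numbered from `0`. -/
def scaledWalk {Ω : Type*} [MeasurableSpace Ω] (P : Measure Ω) {d : ℕ}
    (Z : Fin d → ℕ → Ω → ℝ) (n : ℕ) (ω : Ω) : SkorokhodProd d :=
  fun i => scaledPath n fun j => Z i j ω - ∫ ω', Z i 0 ω' ∂P

open Classical in
/-- The rate function: `∑ i, lam i * #(jumps of ξ i)` if every `ξ i` lies in `𝔻̃_{< ∞}`, and `∞`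
otherwise. -/
def multiRate {d : ℕ} (lam : Fin d → ℝ) (ξ : SkorokhodProd d) : ℝ≥0∞ :=
  if ∀ i, ξ i ∈ SkorokhodSpace.tildeFin then
    ∑ i, ENNReal.ofReal (lam i) * ((ξ i).jumpTimes.encard : ℝ≥0∞)
  else ∞

end

/-! At speed `log n ^ γ`, the walk can leave a neighbourhood of `0` only through finitely many
increments of order `n`. Since `log (n * x) ~ log n`, one increment above `n * x` has probability
`exp (-(lam + o(1)) * log n ^ γ)` whatever `x > 0` is (`decaysAt_tail_mul`), so the rate counts
jumps and ignores their sizes. Since `γ > 1`, powers of `n` are negligible at this speed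
(`DecaysAt.natCast`), so the position of a jump is free as well.

Increments below `n ^ (1 / 4)` average out up to a stretched exponential error, by Hoeffding's
inequality (`decaysAt_truncSumLarge`). The number of increments above that level is bounded by a
constant, up to any prescribed decay (`decaysAt_le_countAbove`).

Upper bound (`decaysAt_scaledWalk_mem`): off negligible events the walk is `ε`-close to the step
path made of its increments above `n * δ`. If the walk is in `F`, this path is in the `ε`-fattening
of `F`, so its jump counts cost at least the infimum of the rate there; finitely many count vectors
remain for a union bound. The fattening is needed because only the approximating path, not the walk,
has finite rate.

Lower bound (`eventually_exp_le_scaledWalk_mem`): a path of finite rate is followed when one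
increment near each jump time falls in a short window above `n` times the jump size and all other
increments stay small. Rapid variation makes the window nearly as likely as the whole tail, and a
time change matches the jump times to the grid.

Lower semicontinuity rests on `mem_tildeFin_and_encard_le_iff`: having at most `k` jumps amounts to
monotonicity, vanishing at `0` and taking at most `k + 1` values, and these properties survive `J₁`
limits. -/

/-! ### Paths with finitely many jumps -/

theorem eventually_eq_of_finite_range {α : Type*} {f : α → ℝ} (hf : (range f).Finite)
    {l : Filter α} {L : ℝ} (h : Tendsto f l (𝓝 L)) : ∀ᶠ t in l, f t = L := by
  have hcl : IsClosed (range f \ {L}) := (hf.subset sdiff_subset).isClosed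
  have hL : (range f \ {L})ᶜ ∈ 𝓝 L := hcl.isOpen_compl.mem_nhds (by simp)
  filter_upwards [h hL] with t ht
  by_contra hne
  exact ht ⟨mem_range_self t, hne⟩

theorem Finset.exists_pos_lt_dist {α : Type*} [MetricSpace α] (T : Finset α) :
    ∃ η : ℝ, 0 < η ∧ ∀ x ∈ T, ∀ y ∈ T, x ≠ y → η < dist x y := by
  have h : ∀ᶠ η : ℝ in 𝓝[>] 0, ∀ x ∈ T, ∀ y ∈ T, x ≠ y → η < dist x y := by
    refine (eventually_all_finset T).2 fun x _ => (eventually_all_finset T).2 fun y _ => ?_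
    by_cases hxy : x = y
    · exact Eventually.of_forall fun _ h => absurd hxy h
    · filter_upwards [nhdsWithin_le_nhds (gt_mem_nhds (dist_pos.2 hxy))] with η hη _ using hη
  obtain ⟨η, h1, h2⟩ := (h.and self_mem_nhdsWithin).exists
  exact ⟨η, h2, h1⟩

namespace SkorokhodSpace

theorem tendsto_leftLim (ξ : SkorokhodSpace) (t : I) :
    Tendsto ξ.toFun (𝓝[<] t) (𝓝 (Function.leftLim ξ.toFun t)) :=
  tendsto_leftLim_of_tendsto (ξ.exists_leftLim t)

theorem mem_tildeFin {ξ : SkorokhodSpace} :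
    ξ ∈ tildeFin ↔ Monotone ξ.toFun ∧ ξ.IsPureJump ∧ ξ 0 = 0 ∧ ξ.jumpTimes.Finite := by
  simp only [tildeFin, tildeEq, monotonePureJump, mem_iUnion, mem_ofPred_eq]
  constructor
  · rintro ⟨j, ⟨h1, h2⟩, h3, h4⟩
    exact ⟨h1, h2, h3, finite_of_encard_eq_coe h4⟩
  · rintro ⟨h1, h2, h3, h4⟩
    exact ⟨h4.toFinset.card, ⟨h1, h2⟩, h3, h4.encard_eq_coe_toFinset_card⟩

theorem hasSum_jumps_iff {ξ : SkorokhodSpace} (hJ : ξ.jumpTimes.Finite) (t : I) (a : ℝ) :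
    HasSum (fun s : Iic t => ξ s - ξ.leftLimit s) a ↔
      ∑ s ∈ hJ.toFinset, (if s ≤ t then ξ s - ξ.leftLimit s else 0) = a := by
  have h1 : HasSum (fun s : Iic t => ξ s - ξ.leftLimit s) a ↔
      HasSum ((Iic t).indicator fun s => ξ s - ξ.leftLimit s) a :=
    hasSum_subtype_iff_indicator (f := fun s => ξ s - ξ.leftLimit s)
  have h2 : HasSum ((Iic t).indicator fun s => ξ s - ξ.leftLimit s)
      (∑ s ∈ hJ.toFinset, (if s ≤ t then ξ s - ξ.leftLimit s else 0)) := by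
    have := hasSum_sum_of_ne_finset_zero (L := .unconditional _)
      (f := (Iic t).indicator fun s => ξ s - ξ.leftLimit s)
      (s := hJ.toFinset) (fun s hs => by
        have : ξ s = ξ.leftLimit s := by simpa [jumpTimes] using hs
        simp [indicator, this])
    simpa [indicator] using this
  rw [h1]
  exact ⟨fun h => h2.unique h, fun h => h ▸ h2⟩

theorem leftLimit_le_of_monotone {ξ : SkorokhodSpace} (hm : Monotone ξ.toFun) (h0 : ξ 0 = 0)
    (t : I) : ξ.leftLimit t ≤ ξ t := by
  rw [leftLimit]
  split_ifs with h
  · rw [h, h0]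
  · exact hm.leftLim_le le_rfl

theorem le_leftLimit_of_monotone {ξ : SkorokhodSpace} (hm : Monotone ξ.toFun) {s t : I}
    (h : s < t) : ξ s ≤ ξ.leftLimit t := by
  rw [leftLimit, if_neg (ne_of_gt (lt_of_le_of_lt unitInterval.nonneg' h))]
  exact hm.le_leftLim h

theorem leftLimit_lt_of_mem_jumpTimes {ξ : SkorokhodSpace} (hm : Monotone ξ.toFun)
    (h0 : ξ 0 = 0) {t : I} (ht : t ∈ ξ.jumpTimes) : ξ.leftLimit t < ξ t :=
  lt_of_le_of_ne (leftLimit_le_of_monotone hm h0 t) (Ne.symm ht)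

theorem zero_notMem_jumpTimes {ξ : SkorokhodSpace} (h0 : ξ 0 = 0) : (0 : I) ∉ ξ.jumpTimes := by
  simp [jumpTimes, leftLimit, h0]

/-- A monotone path rises strictly at each jump, so its values at the jump times are distinct and
nonzero; the value `0` accounts for the extra `1`. -/
theorem encard_jumpTimes_add_one_le {ξ : SkorokhodSpace} (hm : Monotone ξ.toFun)
    (h0 : ξ 0 = 0) : ξ.jumpTimes.encard + 1 ≤ (range ξ.toFun).encard := by
  have hz : (0 : ℝ) ∈ range ξ.toFun := ⟨0, h0⟩
  rw [← encard_sdiff_singleton_add_one hz]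
  refine add_le_add_left (encard_le_encard_of_injOn (f := ξ.toFun) ?_ ?_) 1
  · intro t ht
    refine ⟨mem_range_self t, ?_⟩
    have ht0 : 0 < t := lt_of_le_of_ne unitInterval.nonneg'
      fun h => zero_notMem_jumpTimes h0 (h ▸ ht)
    have h1 := leftLimit_lt_of_mem_jumpTimes hm h0 ht
    have h2 := le_leftLimit_of_monotone hm ht0
    rw [h0] at h2
    exact (lt_of_le_of_lt h2 h1).ne'
  · intro s hs t ht hst
    have key : ∀ {s t : I}, t ∈ ξ.jumpTimes → s < t → ξ s ≠ ξ t := fun ht h =>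
      ((le_leftLimit_of_monotone hm h).trans_lt (leftLimit_lt_of_mem_jumpTimes hm h0 ht)).ne
    rcases lt_trichotomy s t with h | h | h
    · exact absurd hst (key ht h)
    · exact h
    · exact absurd hst.symm (key hs h)

/-- With finite range, one-sided limits are attained near each point. Hence the path minus the sum
of its jumps is locally constant, so constant on the connected interval, and it vanishes at `0`. -/
theorem isPureJump_of_finite_range {ξ : SkorokhodSpace} (h0 : ξ 0 = 0)
    (hr : (range ξ.toFun).Finite) (hJ : ξ.jumpTimes.Finite) : ξ.IsPureJump := by
  intro t
  rw [hasSum_jumps_iff hJ]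
  set Δ : I → ℝ := fun s => ξ s - ξ.leftLimit s
  set D : I → ℝ := fun t => ξ t - ∑ s ∈ hJ.toFinset, (if s ≤ t then Δ s else 0)
  have hD : IsLocallyConstant D := by
    rw [IsLocallyConstant.iff_eventually_eq]
    intro t
    rw [← nhdsLT_sup_nhdsGE t, eventually_sup]
    constructor
    · rcases eq_or_ne t 0 with rfl | ht
      · have : Iio (0 : I) = ∅ := by
          ext s; simp
        simp [this]
      · have h2 : ∀ᶠ u in 𝓝[<] t, ∀ s ∈ hJ.toFinset, (s ≤ u ↔ s < t) := by
          refine (eventually_all_finset _).2 fun s _ => ?_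
          rcases lt_or_ge s t with h | h
          · filter_upwards [nhdsWithin_le_nhds (lt_mem_nhds h)] with u hu
            exact ⟨fun _ => h, fun _ => hu.le⟩
          · filter_upwards [self_mem_nhdsWithin] with u (hu : u < t)
            exact ⟨fun h' => h'.trans_lt hu, fun h' => absurd h h'.not_ge⟩
        filter_upwards [eventually_eq_of_finite_range hr (ξ.tendsto_leftLim t), h2] with u hu hs
        have e1 : ∑ s ∈ hJ.toFinset, (if s ≤ u then Δ s else 0) =
            ∑ s ∈ hJ.toFinset, (if s < t then Δ s else 0) :=
          Finset.sum_congr rfl fun s h => by simp only [hs s h]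
        have e2 : ∑ s ∈ hJ.toFinset, (if s ≤ t then Δ s else 0) =
            ∑ s ∈ hJ.toFinset, (if s < t then Δ s else 0) + Δ t := by
          have : Δ t = ∑ s ∈ hJ.toFinset, (if t = s then Δ t else 0) := by
            rw [Finset.sum_ite_eq]
            split_ifs with h
            · rfl
            · have : ξ t = ξ.leftLimit t := by simpa [jumpTimes] using h
              simp [Δ, this]
          rw [this, ← Finset.sum_add_distrib]
          refine Finset.sum_congr rfl fun s _ => ?_
          rcases lt_trichotomy s t with h | h | h
          · simp [h, h.le, h.ne']
          · simp [h]
          · simp [h.not_ge, h.not_gt, h.ne]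
        have e3 : Δ t = ξ t - Function.leftLim ξ.toFun t := by simp [Δ, leftLimit, ht]
        simp only [D, e1, e2, hu]
        rw [e3]; ring
    · have h2 : ∀ᶠ u in 𝓝[≥] t, ∀ s ∈ hJ.toFinset, (s ≤ u ↔ s ≤ t) := by
        refine (eventually_all_finset _).2 fun s _ => ?_
        rcases le_or_gt s t with h | h
        · filter_upwards [self_mem_nhdsWithin] with u (hu : t ≤ u)
          exact ⟨fun _ => h, fun _ => h.trans hu⟩
        · filter_upwards [nhdsWithin_le_nhds (gt_mem_nhds h)] with u hu
          exact ⟨fun h' => absurd hu h'.not_gt, fun h' => absurd h h'.not_gt⟩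
      filter_upwards [eventually_eq_of_finite_range hr (ξ.rightCont t), h2] with u hu hs
      simp only [D, hu]
      congr 1
      exact Finset.sum_congr rfl fun s h => by simp only [hs s h]
  have h1 : D t = D 0 := hD.apply_eq_of_isPreconnected isPreconnected_univ trivial trivial
  have h2 : D 0 = 0 := by
    have : ∑ s ∈ hJ.toFinset, (if s ≤ 0 then Δ s else 0) = 0 := by
      refine Finset.sum_eq_zero fun s hs => if_neg fun h => ?_
      have : s = 0 := le_antisymm h unitInterval.nonneg'
      exact zero_notMem_jumpTimes h0 (this ▸ hJ.mem_toFinset.1 hs)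
    simp only [D, this, h0, sub_zero]
  have := h1.trans h2
  simp only [D] at this
  linarith

theorem eq_sum_jumps {ξ : SkorokhodSpace} (h : ξ.IsPureJump) (hJ : ξ.jumpTimes.Finite) (t : I) :
    ξ t = ∑ s ∈ hJ.toFinset, (if s ≤ t then ξ s - ξ.leftLimit s else 0) :=
  ((hasSum_jumps_iff hJ t _).1 (h t)).symm

/-- The value at `t` equals the value at the last jump time up to `t`, or `0` if there is none. -/
theorem encard_range_le {ξ : SkorokhodSpace} (h : ξ.IsPureJump) (hJ : ξ.jumpTimes.Finite) :
    (range ξ.toFun).encard ≤ ξ.jumpTimes.encard + 1 := by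
  have hsub : range ξ.toFun ⊆ insert 0 (ξ.toFun '' ξ.jumpTimes) := by
    rintro _ ⟨t, rfl⟩
    rcases (hJ.toFinset.filter (· ≤ t)).eq_empty_or_nonempty with he | hne
    · left
      rw [eq_sum_jumps h hJ, ← Finset.sum_filter, he, Finset.sum_empty]
    · right
      obtain ⟨s, hs, hmax⟩ := Finset.exists_max_image _ id hne
      obtain ⟨hsJ, hst⟩ := Finset.mem_filter.1 hs
      refine ⟨s, hJ.mem_toFinset.1 hsJ, ?_⟩
      rw [eq_sum_jumps h hJ, eq_sum_jumps h hJ]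
      refine Finset.sum_congr rfl fun u hu => ?_
      have : u ≤ s ↔ u ≤ t := ⟨fun h => h.trans hst,
        fun h => hmax u (Finset.mem_filter.2 ⟨hu, h⟩)⟩
      simp only [this]
  refine (encard_le_encard hsub).trans ((encard_insert_le _ _).trans ?_)
  exact add_le_add_left (encard_image_le _ _) 1

/-- The right-hand side is stable under `J₁` limits: a time change leaves the range alone, and a
uniform limit cannot increase the number of values. -/
theorem mem_tildeFin_and_encard_le_iff {ξ : SkorokhodSpace} {k : ℕ} :
    (ξ ∈ tildeFin ∧ ξ.jumpTimes.encard ≤ k) ↔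
      Monotone ξ.toFun ∧ ξ 0 = 0 ∧ (range ξ.toFun).encard ≤ k + 1 := by
  constructor
  · rintro ⟨h, hk⟩
    obtain ⟨h1, h2, h3, h4⟩ := mem_tildeFin.1 h
    exact ⟨h1, h3, (encard_range_le h2 h4).trans (add_le_add_left hk 1)⟩
  · rintro ⟨hm, h0, hk⟩
    have hr : (range ξ.toFun).Finite := finite_of_encard_le_coe (k := k + 1) (by exact_mod_cast hk)
    have hJk : ξ.jumpTimes.encard ≤ k :=
      (ENat.add_le_add_iff_right (by simp)).1 ((encard_jumpTimes_add_one_le hm h0).trans hk)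
    have hJ : ξ.jumpTimes.Finite := finite_of_encard_le_coe hJk
    exact ⟨mem_tildeFin.2 ⟨hm, isPureJump_of_finite_range h0 hr hJ, h0, hJ⟩, hJk⟩

theorem exists_orderIso_of_edist_lt {ξ ζ : SkorokhodSpace} {ε : ℝ}
    (h : edist ξ ζ < ENNReal.ofReal ε) : ∃ m : I ≃o I, ∀ t, |ξ t - ζ (m t)| < ε := by
  obtain ⟨l, hl⟩ := iInf_lt_iff.1 h
  refine ⟨l.symm, fun t => ?_⟩
  have h1 := (le_iSup (fun t : I => edist (ξ (l t)) (ζ t)) (l.symm t)).trans_lt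
    ((le_max_right _ _).trans_lt hl)
  have hε : 0 < ε := ENNReal.ofReal_pos.1 (bot_le.trans_lt h)
  simp only [OrderIso.apply_symm_apply, edist_dist, Real.dist_eq] at h1
  exact (ENNReal.ofReal_lt_ofReal_iff hε).1 h1

theorem isClosed_tildeFin_encard_le (k : ℕ) :
    IsClosed {ξ : SkorokhodSpace | ξ ∈ tildeFin ∧ ξ.jumpTimes.encard ≤ k} := by
  refine isClosed_of_closure_subset fun ξ hξ => ?_
  have happ : ∀ ε : ℝ, 0 < ε → ∃ ζ : SkorokhodSpace, ∃ m : I ≃o I,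
      (Monotone ζ.toFun ∧ ζ 0 = 0 ∧ (range ζ.toFun).encard ≤ k + 1) ∧
        ∀ t, |ξ t - ζ (m t)| < ε := by
    intro ε hε
    obtain ⟨ζ, hζ, hd⟩ := EMetric.mem_closure_iff.1 hξ _ (ENNReal.ofReal_pos.2 hε)
    obtain ⟨m, hm⟩ := exists_orderIso_of_edist_lt hd
    exact ⟨ζ, m, mem_tildeFin_and_encard_le_iff.1 hζ, hm⟩
  refine mem_tildeFin_and_encard_le_iff.2 ⟨fun s t hst => ?_, ?_, ?_⟩
  · refine le_of_forall_pos_le_add fun ε hε => ?_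
    obtain ⟨ζ, m, ⟨hm, -, -⟩, hd⟩ := happ (ε / 2) (half_pos hε)
    have h1 := abs_lt.1 (hd s)
    have h2 := abs_lt.1 (hd t)
    have h3 := hm (m.monotone hst)
    linarith [h1.2, h2.1]
  · refine abs_nonpos_iff.1 (le_of_forall_pos_le_add fun ε hε => ?_)
    obtain ⟨ζ, m, ⟨-, h0, -⟩, hd⟩ := happ ε hε
    have hm0 : m 0 = 0 := le_antisymm
      (by simpa using m.monotone (unitInterval.nonneg' : (0 : I) ≤ m.symm 0)) unitInterval.nonneg'
    have := hd 0
    rw [hm0, h0, sub_zero] at this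
    linarith
  · by_contra hlt
    have hlt' : ((k + 2 : ℕ) : ℕ∞) ≤ (range ξ.toFun).encard := by
      have := Order.add_one_le_of_lt (not_le.1 hlt)
      refine le_trans (le_of_eq ?_) this
      push_cast
      rw [add_assoc]; norm_num
    obtain ⟨T, hT, hTc⟩ := exists_subset_encard_eq hlt'
    have hTf : T.Finite := finite_of_encard_eq_coe hTc
    -- The `k + 2` values are more than `η` apart, so a perturbation below `η / 2` keeps them
    -- distinct and forces `k + 2` values on the approximating path.
    obtain ⟨η, hη, hsep⟩ := hTf.toFinset.exists_pos_lt_dist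
    obtain ⟨ζ, m, ⟨-, -, hc⟩, hd⟩ := happ (η / 2) (half_pos hη)
    choose! u hu using fun x (hx : x ∈ T) => hT hx
    have hle : T.encard ≤ (range ζ.toFun).encard := by
      refine encard_le_encard_of_injOn (f := fun x => ζ (m (u x)))
        (fun x _ => mem_range_self _) fun x hx y hy hxy => ?_
      by_contra hne
      have h1 := hsep x (hTf.mem_toFinset.2 hx) y (hTf.mem_toFinset.2 hy) hne
      have h2 := abs_lt.1 (hd (u x))
      have h3 := abs_lt.1 (hd (u y))
      have hxy' : ζ (m (u x)) = ζ (m (u y)) := hxy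
      rw [hu x hx] at h2
      rw [hu y hy] at h3
      rw [Real.dist_eq] at h1
      rcases abs_cases (x - y) with ⟨h, -⟩ | ⟨h, -⟩ <;> linarith [h2.1, h2.2, h3.1, h3.2]
    have := hle.trans hc
    rw [hTc] at this
    have h' : k + 2 ≤ k + 1 := by exact_mod_cast this
    omega

open Classical in
/-- The number of jumps of a path in `𝔻̃_{< ∞}`, and `∞` for any other path. -/
noncomputable def jumpCount (ξ : SkorokhodSpace) : ℕ∞ :=
  if ξ ∈ tildeFin then ξ.jumpTimes.encard else ⊤

theorem jumpCount_le_coe_iff {ξ : SkorokhodSpace} {k : ℕ} :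
    ξ.jumpCount ≤ k ↔ ξ ∈ tildeFin ∧ ξ.jumpTimes.encard ≤ k := by
  rw [jumpCount]
  split_ifs with h <;> simp [h]

theorem lowerSemicontinuous_jumpCount :
    LowerSemicontinuous fun ξ : SkorokhodSpace => (ξ.jumpCount : ℝ≥0∞) := by
  rw [lowerSemicontinuous_iff_isClosed_preimage]
  intro y
  rcases eq_or_ne y ⊤ with rfl | hy
  · simp
  · have : (fun ξ : SkorokhodSpace => (ξ.jumpCount : ℝ≥0∞)) ⁻¹' Iic y =
        {ξ : SkorokhodSpace | ξ ∈ tildeFin ∧ ξ.jumpTimes.encard ≤ (⌊y.toReal⌋₊ : ℕ)} := by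
      ext ξ
      rw [mem_ofPred_eq, ← jumpCount_le_coe_iff]
      simp only [mem_preimage, mem_Iic]
      generalize ξ.jumpCount = N
      cases N with
      | top => simp [hy]
      | coe N =>
        simp only [ENat.toENNReal_coe, Nat.cast_le]
        rw [Nat.le_floor_iff ENNReal.toReal_nonneg, ← ENNReal.toReal_natCast,
          ENNReal.toReal_le_toReal (by simp) hy]
    rw [this]
    exact isClosed_tildeFin_encard_le _

end SkorokhodSpace

open SkorokhodSpace

theorem edist_apply_le {d : ℕ} (ξ ζ : SkorokhodProd d) (i : Fin d) :
    edist (ξ i) (ζ i) ≤ edist ξ ζ :=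
  Finset.single_le_sum (f := fun i => edist (ξ i) (ζ i)) (fun _ _ => bot_le) (Finset.mem_univ i)

theorem continuous_skorokhodProd_apply {d : ℕ} (i : Fin d) :
    Continuous fun ξ : SkorokhodProd d => ξ i :=
  (LipschitzWith.of_edist_le fun ξ ζ => edist_apply_le ξ ζ i).continuous

/-- Positivity of the weights lets an infinite `jumpCount` absorb the case distinction, leaving a
sum of lower semicontinuous functions. -/
theorem multiRate_eq_sum {d : ℕ} {lam : Fin d → ℝ} (hlam : ∀ i, 0 < lam i) (ξ : SkorokhodProd d) :
    multiRate lam ξ = ∑ i, ENNReal.ofReal (lam i) * ((ξ i).jumpCount : ℝ≥0∞) := by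
  rw [multiRate]
  split_ifs with h
  · simp only [jumpCount, if_pos (h _)]
  · obtain ⟨i, hi⟩ := not_forall.1 h
    symm
    rw [ENNReal.sum_eq_top]
    refine ⟨i, Finset.mem_univ i, ?_⟩
    rw [jumpCount, if_neg hi, ENat.toENNReal_top, ENNReal.mul_top]
    simpa using hlam i

theorem lowerSemicontinuous_multiRate {d : ℕ} {lam : Fin d → ℝ} (hlam : ∀ i, 0 < lam i) :
    LowerSemicontinuous (multiRate lam) := by
  have : multiRate lam = fun ξ => ∑ i, ENNReal.ofReal (lam i) * ((ξ i).jumpCount : ℝ≥0∞) :=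
    funext (multiRate_eq_sum hlam)
  rw [this]
  refine lowerSemicontinuous_sum fun i _ => ?_
  refine (ENNReal.continuous_const_mul ENNReal.ofReal_ne_top).comp_lowerSemicontinuous
    (f := fun ξ : SkorokhodProd d => ((ξ i).jumpCount : ℝ≥0∞)) ?_
    fun a b h => mul_le_mul_right h _
  exact lowerSemicontinuous_jumpCount.comp (continuous_skorokhodProd_apply i)

/-! ### Comparison of scaled paths -/

theorem edist_le_of_orderIso {ξ ζ : SkorokhodSpace} {ε : ℝ} (l : I ≃o I)
    (h1 : ∀ t, |(l t : ℝ) - t| ≤ ε) (h2 : ∀ t, |ξ (l t) - ζ t| ≤ ε) :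
    edist ξ ζ ≤ ENNReal.ofReal ε := by
  refine iInf_le_of_le l (max_le (iSup_le fun t => ?_) (iSup_le fun t => ?_))
  · rw [edist_dist, Subtype.dist_eq, Real.dist_eq]
    exact ENNReal.ofReal_le_ofReal (h1 t)
  · rw [edist_dist, Real.dist_eq]
    exact ENNReal.ofReal_le_ofReal (h2 t)

theorem floor_mul_le (n : ℕ) (t : I) : ⌊(n : ℝ) * t⌋₊ ≤ n := by
  refine Nat.floor_le_of_le ?_
  have := mul_le_mul_of_nonneg_left t.2.2 n.cast_nonneg (α := ℝ)
  simpa using this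

theorem edist_scaledPath_le {n : ℕ} {z w : ℕ → ℝ} {ε : ℝ} (hε : 0 ≤ ε)
    (h : ∀ k ≤ n, |∑ j ∈ Finset.range k, (z j - w j)| ≤ n * ε) :
    edist (scaledPath n z) (scaledPath n w) ≤ ENNReal.ofReal ε := by
  refine edist_le_of_orderIso (OrderIso.refl I) (fun t => by simpa using hε) fun t => ?_
  have h1 := h _ (floor_mul_le n t)
  simp only [scaledPath, OrderIso.refl_apply]
  rw [← mul_sub, ← Finset.sum_sub_distrib, abs_mul, abs_of_nonneg (by positivity)]
  rcases Nat.eq_zero_or_pos n with rfl | hn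
  · simpa using hε
  · have hn' : (0 : ℝ) < n := by exact_mod_cast hn
    rw [one_div, inv_mul_le_iff₀ hn']
    exact h1

theorem scaledPath_congr {n : ℕ} {z w : ℕ → ℝ} (h : ∀ j < n, z j = w j) :
    scaledPath n z = scaledPath n w := by
  have : (scaledPath n z).toFun = (scaledPath n w).toFun := by
    funext t
    simp only [scaledPath]
    congr 1
    exact Finset.sum_congr rfl fun j hj =>
      h j ((Finset.mem_range.1 hj).trans_le (floor_mul_le n t))
  cases h1 : scaledPath n z
  cases h2 : scaledPath n w
  simp only [h1, h2] at this
  subst this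
  rfl

/-- The vector of scaled paths with given increments. -/
noncomputable def scaledPathProd (d n : ℕ) (w : Fin d → Fin n → ℝ) : SkorokhodProd d :=
  fun i => scaledPath n fun j => if h : j < n then w i ⟨j, h⟩ else 0

/-- Measurability of the walk comes from here: it is a continuous image of finitely many real
variables. The factor `1 / n` offsets the `n` summands, so each coordinate is `1`-Lipschitz. -/
theorem continuous_scaledPathProd (d n : ℕ) : Continuous (scaledPathProd d n) := by
  refine LipschitzWith.continuous (K := d) fun w w' => ?_
  have h : ∀ i, edist (scaledPathProd d n w i) (scaledPathProd d n w' i) ≤ edist w w' := by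
    intro i
    rw [edist_dist w w']
    refine edist_scaledPath_le dist_nonneg fun k hk => ?_
    refine (Finset.abs_sum_le_sum_abs _ _).trans ?_
    have : ∀ j ∈ Finset.range k, |(if h : j < n then w i ⟨j, h⟩ else 0) -
        (if h : j < n then w' i ⟨j, h⟩ else 0)| ≤ dist w w' := by
      intro j hj
      have hjn : j < n := (Finset.mem_range.1 hj).trans_le hk
      rw [dif_pos hjn, dif_pos hjn, ← Real.dist_eq]
      exact (dist_le_pi_dist (w i) (w' i) _).trans (dist_le_pi_dist w w' i)
    refine (Finset.sum_le_card_nsmul _ _ _ this).trans ?_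
    rw [Finset.card_range, nsmul_eq_mul]
    exact mul_le_mul_of_nonneg_right (by exact_mod_cast hk) dist_nonneg
  calc edist (scaledPathProd d n w) (scaledPathProd d n w')
      ≤ ∑ _i : Fin d, edist w w' := Finset.sum_le_sum fun i _ => h i
    _ = _ := by simp

theorem measurable_scaledWalk {Ω : Type*} [MeasurableSpace Ω] (P : Measure Ω) {d : ℕ}
    {Z : Fin d → ℕ → Ω → ℝ} (hZ : ∀ i j, Measurable (Z i j)) (n : ℕ) :
    Measurable (scaledWalk P Z n) := by
  have : scaledWalk P Z n = scaledPathProd d n ∘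
      fun ω i (j : Fin n) => Z i j ω - ∫ ω', Z i 0 ω' ∂P := by
    funext ω i
    exact scaledPath_congr fun j hj => by simp [hj]
  rw [this]
  refine (continuous_scaledPathProd d n).measurable.comp ?_
  exact measurable_pi_lambda _ fun i => measurable_pi_lambda _ fun j => (hZ i j).sub_const _

/-- A scaled path with nonnegative increments has at most as many jumps as nonzero increments. -/
theorem jumpCount_scaledPath_le {n : ℕ} {w : ℕ → ℝ} (hw : ∀ j < n, 0 ≤ w j) :
    (scaledPath n w).jumpCount ≤ (((Finset.range n).filter (w · ≠ 0)).card : ℕ) := by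
  rw [jumpCount_le_coe_iff, mem_tildeFin_and_encard_le_iff]
  set A := (Finset.range n).filter (w · ≠ 0)
  set S : ℕ → ℝ := fun k => 1 / (n : ℝ) * ∑ j ∈ Finset.range k, w j
  refine ⟨fun s t hst => ?_, by simp [scaledPath], ?_⟩
  · refine mul_le_mul_of_nonneg_left ?_ (by positivity)
    refine Finset.sum_le_sum_of_subset_of_nonneg ?_ fun j hj _ =>
      hw j ((Finset.mem_range.1 hj).trans_le (floor_mul_le n t))
    refine Finset.range_subset_range.2 (Nat.floor_le_floor ?_)
    exact mul_le_mul_of_nonneg_left hst n.cast_nonneg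
  -- Partial sums change only right after a nonzero increment.
  · have key : ∀ k ≤ n, S k ∈ insert 0 (A.image fun j => S (j + 1)) := by
      intro k
      induction k with
      | zero => intro _; simp [S]
      | succ k ih =>
        intro hk
        by_cases hz : w k = 0
        · have : S (k + 1) = S k := by simp [S, Finset.sum_range_succ, hz]
          rw [this]
          exact ih (by omega)
        · refine Finset.mem_insert_of_mem (Finset.mem_image_of_mem _ ?_)
          exact Finset.mem_filter.2 ⟨Finset.mem_range.2 (by omega), hz⟩
    have hsub : range (scaledPath n w).toFun ⊆ ↑(insert 0 (A.image fun j => S (j + 1))) := by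
      rintro _ ⟨t, rfl⟩
      exact key _ (floor_mul_le n t)
    refine (encard_le_encard hsub).trans ?_
    rw [encard_coe_eq_coe_finsetCard]
    exact_mod_cast (Finset.card_insert_le _ _).trans (Nat.succ_le_succ Finset.card_image_le)

/-! ### Time changes -/

/-- Perturb the identity by tents of height `1` and half-width `η` at the points of `J`, weighted by
the displacements. No tent reaches another point of `J`, so the values there are exact; the
perturbation has Lipschitz constant below `1`, so the map stays strictly increasing. It is onto
because the endpoints are fixed. -/
theorem exists_orderIso_eqOn {J : Finset I} (τ : I → I) (h0 : 0 ∈ J) (h1 : 1 ∈ J)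
    (hτ0 : τ 0 = 0) (hτ1 : τ 1 = 1) {η : ℝ} (hη : 0 < η)
    (hsep : ∀ s ∈ J, ∀ t ∈ J, s ≠ t → η < dist s t)
    (hτ : ∑ s ∈ J, |(τ s : ℝ) - s| < η) :
    ∃ l : I ≃o I, (∀ s ∈ J, l s = τ s) ∧ ∀ t, |(l t : ℝ) - t| ≤ ∑ s ∈ J, |(τ s : ℝ) - s| := by
  set g : ℝ → ℝ → ℝ := fun s t => max (1 - |t - s| / η) 0
  have hg0 : ∀ s t, 0 ≤ g s t := fun s t => le_max_right _ _
  have hg1 : ∀ s t, g s t ≤ 1 := fun s t =>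
    max_le (sub_le_self _ (by positivity)) zero_le_one
  have hgl : ∀ s t u, |g s t - g s u| ≤ |t - u| / η := by
    intro s t u
    refine (abs_max_sub_max_le_abs _ _ _).trans ?_
    rw [show (1 - |t - s| / η) - (1 - |u - s| / η) = (|u - s| - |t - s|) / η by ring, abs_div,
      abs_of_pos hη]
    refine div_le_div_of_nonneg_right ((abs_abs_sub_abs_le_abs_sub _ _).trans_eq ?_) hη.le
    rw [sub_sub_sub_cancel_right, abs_sub_comm]
  set φ : ℝ → ℝ := fun t => t + ∑ s ∈ J, ((τ s : ℝ) - s) * g s t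
  have hcont : Continuous φ := by fun_prop
  have hφJ : ∀ s ∈ J, φ s = τ s := by
    intro t ht
    have : ∑ s ∈ J, ((τ s : ℝ) - s) * g s t = ((τ t : ℝ) - t) * g t t := by
      refine Finset.sum_eq_single_of_mem t ht fun s hs hst => ?_
      have h := hsep t ht s hs hst.symm
      rw [Subtype.dist_eq, Real.dist_eq] at h
      have : g s t = 0 := max_eq_right (by
        rw [sub_nonpos, le_div_iff₀ hη]; linarith)
      rw [this, mul_zero]
    have hgt : g t t = 1 := by simp [g]
    simp only [φ, this, hgt]
    ring
  have hmono : StrictMono φ := by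
    intro t u htu
    have h : |∑ s ∈ J, ((τ s : ℝ) - s) * g s t - ∑ s ∈ J, ((τ s : ℝ) - s) * g s u| < u - t := by
      rw [← Finset.sum_sub_distrib]
      refine (Finset.abs_sum_le_sum_abs _ _).trans_lt ?_
      have : ∀ s ∈ J, |((τ s : ℝ) - s) * g s t - ((τ s : ℝ) - s) * g s u| ≤
          |(τ s : ℝ) - s| * (|t - u| / η) := by
        intro s _
        rw [← mul_sub, abs_mul]
        exact mul_le_mul_of_nonneg_left (hgl _ _ _) (abs_nonneg _)
      refine (Finset.sum_le_sum this).trans_lt ?_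
      rw [← Finset.sum_mul, abs_sub_comm, abs_of_pos (sub_pos.2 htu), mul_div_assoc',
        div_lt_iff₀ hη, mul_comm]
      exact mul_lt_mul_of_pos_left hτ (sub_pos.2 htu)
    have := (abs_lt.1 h).2
    simp only [φ]
    linarith
  have e0 : φ 0 = 0 := by simpa [hτ0] using hφJ 0 h0
  have e1 : φ 1 = 1 := by simpa [hτ1] using hφJ 1 h1
  have hmaps : ∀ t : I, φ t ∈ I := fun t =>
    ⟨e0 ▸ hmono.monotone t.2.1, e1 ▸ hmono.monotone t.2.2⟩
  have hsurj : Function.Surjective fun t : I => (⟨φ t, hmaps t⟩ : I) := by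
    intro y
    obtain ⟨x, hx, hxy⟩ := intermediate_value_Icc zero_le_one hcont.continuousOn
      (show (y : ℝ) ∈ Icc (φ 0) (φ 1) by rw [e0, e1]; exact y.2)
    exact ⟨⟨x, hx⟩, Subtype.ext hxy⟩
  refine ⟨StrictMono.orderIsoOfSurjective _ (fun t u h => ?_) hsurj, fun s hs => ?_, fun t => ?_⟩
  · exact hmono h
  · exact Subtype.ext (hφJ s hs)
  · show |φ t - t| ≤ _
    simp only [φ, add_sub_cancel_left]
    refine (Finset.abs_sum_le_sum_abs _ _).trans (Finset.sum_le_sum fun s _ => ?_)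
    rw [abs_mul, abs_of_nonneg (hg0 _ _)]
    exact mul_le_of_le_one_right (abs_nonneg _) (hg1 _ _)

/-- The index of the increment of a scaled path with `n` steps that is used for a jump at time
`s`. -/
noncomputable def jumpIndex (n : ℕ) (s : I) : ℕ := ⌈(n : ℝ) * s⌉₊ - 1

theorem jumpIndex_lt {n : ℕ} (hn : 0 < n) (s : I) : jumpIndex n s < n := by
  have : ⌈(n : ℝ) * s⌉₊ ≤ n := Nat.ceil_le.2 (mul_le_of_le_one_right n.cast_nonneg s.2.2)
  unfold jumpIndex
  omega

/-- A time change carries each jump time `s` to the grid time `⌈n * s⌉₊ / n`. The two paths then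
agree exactly, and only the time displacement, at most `K.card / n`, is left. -/
theorem eventually_edist_scaledPath_step_le {ξ : SkorokhodSpace} {J : Finset I} {x : I → ℝ}
    (hξ : ∀ t, ξ t = ∑ s ∈ J, if s ≤ t then x s else 0) (h0 : 0 ∉ J) {ε : ℝ} (hε : 0 < ε) :
    ∀ᶠ n : ℕ in atTop, InjOn (jumpIndex n) J ∧
      edist (scaledPath n fun j => n * ∑ s ∈ J, if jumpIndex n s = j then x s else 0) ξ ≤
        ENNReal.ofReal ε := by
  classical
  -- The endpoints join the prescribed points because a time change must fix them.
  set K : Finset I := insert 0 (insert 1 J)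
  obtain ⟨η, hη, hsep⟩ := K.exists_pos_lt_dist
  have hlim : Tendsto (fun n : ℕ => (K.card : ℝ) / n) atTop (𝓝 0) :=
    tendsto_const_div_atTop_nhds_zero_nat _
  filter_upwards [eventually_gt_atTop 0, hlim.eventually (gt_mem_nhds (lt_min hη hε))]
    with n hn hnK
  have hn' : (0 : ℝ) < n := by exact_mod_cast hn
  set τ : I → I := fun s => ⟨⌈(n : ℝ) * s⌉₊ / n, by positivity, by
    rw [div_le_one hn']
    exact_mod_cast Nat.ceil_le.2 (mul_le_of_le_one_right n.cast_nonneg s.2.2)⟩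
  have hτ : ∀ s, |(τ s : ℝ) - s| ≤ 1 / n := by
    intro s
    have h1 := Nat.le_ceil ((n : ℝ) * s)
    have h2 := Nat.ceil_lt_add_one (mul_nonneg hn'.le s.2.1)
    rw [abs_of_nonneg]
    · simp only [τ]
      rw [div_sub' hn'.ne']
      gcongr
      linarith
    · simp only [τ]
      rw [sub_nonneg, le_div_iff₀ hn']
      linarith
  have hsum : ∑ s ∈ K, |(τ s : ℝ) - s| ≤ K.card / n := by
    refine (Finset.sum_le_card_nsmul _ _ _ fun s _ => hτ s).trans_eq ?_
    rw [nsmul_eq_mul]; ring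
  obtain ⟨l, hl, hld⟩ := exists_orderIso_eqOn (J := K) τ (by simp [K]) (by simp [K])
    (by simp [τ]) (by ext; simp [τ, hn'.ne']) hη hsep
    (hsum.trans_lt (hnK.trans_le (min_le_left _ _)))
  have hJK : ∀ s ∈ J, s ∈ K := fun s hs => by simp [K, hs]
  have hpos : ∀ s ∈ J, 0 < ⌈(n : ℝ) * s⌉₊ := by
    intro s hs
    have : (0 : ℝ) < s := lt_of_le_of_ne s.2.1 fun h => h0 (by
      have : s = 0 := Subtype.ext h.symm
      exact this ▸ hs)
    exact Nat.ceil_pos.2 (by positivity)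
  refine ⟨fun s hs t ht hst => ?_, edist_le_of_orderIso l (fun t => (hld t).trans ?_) fun t => ?_⟩
  · have : ⌈(n : ℝ) * s⌉₊ = ⌈(n : ℝ) * t⌉₊ := by
      have h1 := hpos s hs
      have h2 := hpos t ht
      simp only [jumpIndex] at hst
      omega
    refine l.injective ?_
    rw [hl s (hJK s hs), hl t (hJK t ht)]
    simp only [τ, this]
  · exact hsum.trans (hnK.le.trans (min_le_right _ _))
  · have : scaledPath n (fun j => n * ∑ s ∈ J, if jumpIndex n s = j then x s else 0) (l t) =
        ξ t := by
      rw [hξ]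
      simp only [scaledPath]
      rw [← Finset.mul_sum, ← mul_assoc, one_div, inv_mul_cancel₀ hn'.ne', one_mul,
        Finset.sum_comm]
      refine Finset.sum_congr rfl fun s hs => ?_
      rw [Finset.sum_ite_eq]
      -- Increments are numbered from `0`, so the one with index `⌈n * s⌉₊ - 1` takes effect at time
      -- `τ s = l s`. As `s > 0`, the subtraction in `ℕ` is not truncated.
      have : jumpIndex n s ∈ Finset.range ⌊(n : ℝ) * l t⌋₊ ↔ s ≤ t := by
        rw [Finset.mem_range, ← l.le_iff_le, hl s (hJK s hs), ← Subtype.coe_le_coe]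
        simp only [τ]
        rw [div_le_iff₀ hn', mul_comm (l t : ℝ), ← Nat.le_floor_iff (mul_nonneg hn'.le (l t).2.1)]
        have := hpos s hs
        simp only [jumpIndex]
        omega
      simp only [this]
    rw [this]
    simpa using hε.le

/-! ### Exponential decay at speed `log n ^ γ` -/

theorem tendsto_log_natCast_atTop : Tendsto (fun n : ℕ => Real.log n) atTop atTop :=
  Real.tendsto_log_atTop.comp tendsto_natCast_atTop_atTop

theorem tendsto_log_rpow_atTop {γ : ℝ} (hγ : 0 < γ) :
    Tendsto (fun n : ℕ => Real.log n ^ γ) atTop atTop :=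
  (tendsto_rpow_atTop hγ).comp tendsto_log_natCast_atTop

/-- The sequence `p` is eventually bounded by `exp (-M' * log n ^ γ)` for every `M' < M`. -/
def DecaysAt (γ M : ℝ) (p : ℕ → ℝ) : Prop :=
  ∀ M' < M, ∀ᶠ n : ℕ in atTop, p n ≤ Real.exp (-M' * Real.log n ^ γ)

namespace DecaysAt

variable {γ M N : ℝ} {p q : ℕ → ℝ}

theorem mono (h : DecaysAt γ M q) (hpq : ∀ᶠ n in atTop, p n ≤ q n) : DecaysAt γ M p :=
  fun M' hM' => by filter_upwards [h M' hM', hpq] with n h1 h2 using h2.trans h1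

theorem anti (h : DecaysAt γ M p) (hN : N ≤ M) : DecaysAt γ N p :=
  fun M' hM' => h M' (hM'.trans_le hN)

theorem add (hγ : 0 < γ) (hp : DecaysAt γ M p) (hq : DecaysAt γ M q) :
    DecaysAt γ M fun n => p n + q n := by
  intro M' hM'
  obtain ⟨M'', h1, h2⟩ := exists_between hM'
  have h3 : Tendsto (fun n : ℕ => (M'' - M') * Real.log n ^ γ) atTop atTop :=
    (tendsto_log_rpow_atTop hγ).const_mul_atTop (sub_pos.2 h1)
  filter_upwards [hp M'' h2, hq M'' h2, h3.eventually_ge_atTop (Real.log 2)] with n hp hq h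
  have h4 : 2 * Real.exp (-M'' * Real.log n ^ γ) ≤ Real.exp (-M' * Real.log n ^ γ) := by
    rw [← Real.exp_log (zero_lt_two' ℝ), ← Real.exp_add, Real.exp_le_exp]
    linarith
  linarith

theorem zero : DecaysAt γ M fun _ => 0 :=
  fun _ _ => Eventually.of_forall fun _ => (Real.exp_pos _).le

theorem sum (hγ : 0 < γ) {ι : Type*} (s : Finset ι) {f : ι → ℕ → ℝ}
    (h : ∀ i ∈ s, DecaysAt γ M (f i)) : DecaysAt γ M fun n => ∑ i ∈ s, f i n := by
  classical
  induction s using Finset.induction_on with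
  | empty => simpa using zero
  | insert a s ha ih =>
    simp only [Finset.sum_insert ha]
    exact (h a (Finset.mem_insert_self a s)).add hγ
      (ih fun i hi => h i (Finset.mem_insert_of_mem hi))

theorem mul (hq0 : ∀ n, 0 ≤ q n) (hp : DecaysAt γ M p)
    (hq : DecaysAt γ N q) : DecaysAt γ (M + N) fun n => p n * q n := by
  intro M' hM'
  filter_upwards [hp (M - (M + N - M') / 2) (by linarith),
    hq (N - (M + N - M') / 2) (by linarith)] with n h1 h2
  refine (mul_le_mul h1 h2 (hq0 n) (Real.exp_pos _).le).trans_eq ?_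
  rw [← Real.exp_add]
  ring_nf

theorem one (hγ : 0 < γ) : DecaysAt γ 0 fun _ => 1 := by
  intro M' hM'
  filter_upwards [(tendsto_log_rpow_atTop hγ).eventually_ge_atTop 0] with n hn
  exact Real.one_le_exp (mul_nonneg (by linarith) hn)

theorem prod (hγ : 0 < γ) {ι : Type*} (s : Finset ι) {f : ι → ℕ → ℝ} {M : ι → ℝ}
    (h0 : ∀ i ∈ s, ∀ n, 0 ≤ f i n) (h : ∀ i ∈ s, DecaysAt γ (M i) (f i)) :
    DecaysAt γ (∑ i ∈ s, M i) fun n => ∏ i ∈ s, f i n := by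
  classical
  induction s using Finset.induction_on with
  | empty => simpa using one hγ
  | insert a s ha ih =>
    simp only [Finset.sum_insert ha, Finset.prod_insert ha]
    exact (h a (Finset.mem_insert_self a s)).mul
      (fun n => Finset.prod_nonneg fun i hi => h0 i (Finset.mem_insert_of_mem hi) n)
      (ih (fun i hi => h0 i (Finset.mem_insert_of_mem hi))
        fun i hi => h i (Finset.mem_insert_of_mem hi))

theorem pow (hγ : 0 < γ) (k : ℕ) (h0 : ∀ n, 0 ≤ p n) (h : DecaysAt γ M p) :
    DecaysAt γ (k * M) fun n => p n ^ k := by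
  simpa using prod hγ (Finset.range k) (f := fun _ => p) (M := fun _ => M)
    (fun _ _ => h0) fun _ _ => h

/-- Here `γ > 1` makes `log n` negligible against `log n ^ γ`, so union bounds over polynomially
many indices cost nothing. -/
theorem natCast (hγ : 1 < γ) : DecaysAt γ 0 fun n => (n : ℝ) := by
  intro M' hM'
  have h : Tendsto (fun n : ℕ => Real.log n ^ (γ - 1)) atTop atTop :=
    tendsto_log_rpow_atTop (sub_pos.2 hγ)
  filter_upwards [h.eventually_ge_atTop (1 / -M'), eventually_gt_atTop 1] with n hn h1
  have hlog : 0 < Real.log n := Real.log_pos (by exact_mod_cast h1)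
  have hn0 : (0 : ℝ) < n := by exact_mod_cast (by omega : 0 < n)
  rw [← Real.log_le_iff_le_exp hn0]
  have : Real.log n ^ γ = Real.log n ^ (γ - 1) * Real.log n := by
    rw [Real.rpow_sub_one hlog.ne', div_mul_cancel₀ _ hlog.ne']
  rw [this, ← mul_assoc]
  rw [div_le_iff₀ (by linarith)] at hn
  nlinarith

/-- Every power of `log n` is `o(n ^ s)`, so stretched exponentials decay at every rate `M`. -/
theorem exp_neg_rpow {c s : ℝ} (hc : 0 < c) (hs : 0 < s) :
    DecaysAt γ M fun n => Real.exp (-(c * (n : ℝ) ^ s)) := by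
  intro M' _
  have h := (isLittleO_log_rpow_rpow_atTop γ hs).comp_tendsto tendsto_natCast_atTop_atTop
  have h2 := h.bound (show 0 < c / (|M'| + 1) by positivity)
  filter_upwards [h2] with n hn
  rw [Real.exp_le_exp]
  simp only [Function.comp_apply, Real.norm_eq_abs] at hn
  rw [abs_of_nonneg (by positivity : (0 : ℝ) ≤ (n : ℝ) ^ s), div_mul_eq_mul_div,
    le_div_iff₀ (by positivity)] at hn
  have h3 : M' * Real.log n ^ γ ≤ |M'| * |Real.log n ^ γ| := by
    rw [← abs_mul]; exact le_abs_self _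
  nlinarith [abs_nonneg (Real.log n ^ γ)]

theorem tendsto_zero (hγ : 0 < γ) (hM : 0 < M) (h0 : ∀ n, 0 ≤ p n) (h : DecaysAt γ M p) :
    Tendsto p atTop (𝓝 0) := by
  have h1 : Tendsto (fun n : ℕ => -(M / 2) * Real.log n ^ γ) atTop atBot :=
    (tendsto_log_rpow_atTop hγ).const_mul_atTop_of_neg (by linarith)
  exact squeeze_zero' (Eventually.of_forall h0) (h (M / 2) (by linarith))
    (Real.tendsto_exp_atBot.comp h1)

end DecaysAt

/-! ### Tail estimates for lognormal-type laws -/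

/-- Truncation at level `b`: values above `b` are replaced by `0`. -/
noncomputable def truncAbove (b x : ℝ) : ℝ := if x ≤ b then x else 0

theorem measurable_truncAbove (b : ℝ) : Measurable (truncAbove b) :=
  Measurable.ite measurableSet_Iic measurable_id measurable_const

namespace IsLognormalType

variable {ρ : Measure ℝ} {γ lam : ℝ}

theorem exists_real_tail [IsProbabilityMeasure ρ] (h : IsLognormalType ρ γ lam) : ∃ r : ℝ → ℝ,
    Tendsto (fun y => r y / y ^ γ) atTop (𝓝 lam) ∧
    (∀ h : ℝ, 0 < h → Tendsto (fun y => r (y + h) - r y) atTop atTop) ∧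
    ∀ᶠ x in atTop, ρ.real (Ioi x) = Real.exp (-r (Real.log x)) := by
  obtain ⟨r, -, h1, h2, h3⟩ := h.tail
  refine ⟨r, h1, h2, ?_⟩
  filter_upwards [h3] with x hx
  rw [measureReal_def, hx, ENNReal.toReal_ofReal (Real.exp_pos _).le]

/-- `r (log c_n) / log n ^ γ → lam * a ^ γ` if `log c_n / log n → a`. -/
theorem tendsto_exponent_div {r : ℝ → ℝ}
    (hr : Tendsto (fun y => r y / y ^ γ) atTop (𝓝 lam)) {c : ℕ → ℝ} {a : ℝ} (ha : 0 < a)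
    (hc : Tendsto (fun n => Real.log (c n) / Real.log n) atTop (𝓝 a)) :
    Tendsto (fun n : ℕ => r (Real.log (c n)) / Real.log n ^ γ) atTop (𝓝 (lam * a ^ γ)) ∧
      Tendsto (fun n => Real.log (c n)) atTop atTop := by
  have hL := tendsto_log_natCast_atTop
  have h0 : ∀ᶠ n : ℕ in atTop, Real.log n ≠ 0 :=
    (hL.eventually_gt_atTop 0).mono fun n h => h.ne'
  have h1 : Tendsto (fun n => Real.log (c n)) atTop atTop := by
    refine (hc.pos_mul_atTop ha hL).congr' ?_
    filter_upwards [h0] with n hn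
    rw [div_mul_cancel₀ _ hn]
  refine ⟨?_, h1⟩
  have h2 : Tendsto (fun n => (Real.log (c n) / Real.log n) ^ γ) atTop (𝓝 (a ^ γ)) :=
    hc.rpow_const (Or.inl ha.ne')
  refine ((hr.comp h1).mul h2).congr' ?_
  filter_upwards [hL.eventually_gt_atTop 0, h1.eventually_gt_atTop 0] with n hn hcn
  have hp : Real.log (c n) ^ γ ≠ 0 := (Real.rpow_pos_of_pos hcn γ).ne'
  have hq : Real.log n ^ γ ≠ 0 := (Real.rpow_pos_of_pos hn γ).ne'
  rw [Function.comp_apply, Real.div_rpow hcn.le hn.le]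
  field_simp

theorem tendsto_log_mul_div {x : ℝ} (hx : 0 < x) :
    Tendsto (fun n : ℕ => Real.log (n * x) / Real.log n) atTop (𝓝 1) := by
  have h1 : Tendsto (fun n : ℕ => 1 + Real.log x / Real.log n) atTop (𝓝 (1 + 0)) :=
    tendsto_const_nhds.add (tendsto_log_natCast_atTop.const_div_atTop _)
  rw [add_zero] at h1
  refine h1.congr' ?_
  filter_upwards [tendsto_log_natCast_atTop.eventually_gt_atTop 0, eventually_gt_atTop 0]
    with n hn hn0
  rw [Real.log_mul (by exact_mod_cast hn0.ne') hx.ne']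
  field_simp

theorem tendsto_log_rpow_div (a : ℝ) :
    Tendsto (fun n : ℕ => Real.log ((n : ℝ) ^ a) / Real.log n) atTop (𝓝 a) := by
  refine tendsto_const_nhds.congr' ?_
  filter_upwards [tendsto_log_natCast_atTop.eventually_gt_atTop 0, eventually_gt_atTop 0]
    with n hn hn0
  rw [Real.log_rpow (by exact_mod_cast hn0)]
  field_simp

theorem decaysAt_tail [IsProbabilityMeasure ρ] (h : IsLognormalType ρ γ lam)
    {c : ℕ → ℝ} {a : ℝ} (ha : 0 < a) (hc0 : Tendsto c atTop atTop)
    (hc : Tendsto (fun n => Real.log (c n) / Real.log n) atTop (𝓝 a)) :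
    DecaysAt γ (lam * a ^ γ) fun n => ρ.real (Ioi (c n)) := by
  obtain ⟨r, h1, -, h3⟩ := h.exists_real_tail
  obtain ⟨h4, -⟩ := tendsto_exponent_div h1 ha hc
  intro M' hM'
  filter_upwards [h4.eventually (lt_mem_nhds hM'), hc0.eventually h3,
    tendsto_log_natCast_atTop.eventually_gt_atTop 0] with n hn hn3 hn0
  rw [hn3, Real.exp_le_exp]
  rw [lt_div_iff₀ (Real.rpow_pos_of_pos hn0 γ)] at hn
  linarith

/-- The rate does not depend on `x`: a jump costs the same whatever its size. -/
theorem decaysAt_tail_mul [IsProbabilityMeasure ρ] (h : IsLognormalType ρ γ lam)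
    {x : ℝ} (hx : 0 < x) : DecaysAt γ lam fun n => ρ.real (Ioi (n * x)) := by
  simpa using h.decaysAt_tail one_pos (tendsto_natCast_atTop_atTop.atTop_mul_const hx)
    (tendsto_log_mul_div hx)

theorem decaysAt_tail_rpow [IsProbabilityMeasure ρ] (h : IsLognormalType ρ γ lam)
    {a : ℝ} (ha : 0 < a) : DecaysAt γ (lam * a ^ γ) fun n => ρ.real (Ioi ((n : ℝ) ^ a)) :=
  h.decaysAt_tail ha ((tendsto_rpow_atTop ha).comp tendsto_natCast_atTop_atTop)
    (tendsto_log_rpow_div a)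

/-- Rapid variation enters here, with `h = log ((x + η) / x)`: the tail at `n * (x + η)` is
eventually at most half the tail at `n * x`, so the window keeps at least half of the mass. -/
theorem eventually_exp_le_real_Ioc [IsProbabilityMeasure ρ] (h : IsLognormalType ρ γ lam)
    (hγ : 0 < γ) {x η M : ℝ} (hx : 0 < x) (hη : 0 < η) (hM : lam < M) :
    ∀ᶠ n : ℕ in atTop,
      Real.exp (-M * Real.log n ^ γ) ≤ ρ.real (Ioc ((n : ℝ) * x) (n * (x + η))) := by
  obtain ⟨r, h1, h2, h3⟩ := h.exists_real_tail
  obtain ⟨h4, h5⟩ := tendsto_exponent_div h1 one_pos (tendsto_log_mul_div hx)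
  rw [Real.one_rpow, mul_one] at h4
  obtain ⟨M', hM1, hM2⟩ := exists_between hM
  have hxη : 0 < x + η := by positivity
  have hlog : 0 < Real.log ((x + η) / x) := Real.log_pos (by rw [one_lt_div hx]; linarith)
  have hnx : ∀ y : ℝ, 0 < y → Tendsto (fun n : ℕ => (n : ℝ) * y) atTop atTop :=
    fun y hy => tendsto_natCast_atTop_atTop.atTop_mul_const hy
  have h6 : Tendsto (fun n : ℕ => (M - M') * Real.log n ^ γ) atTop atTop :=
    (tendsto_log_rpow_atTop hγ).const_mul_atTop (sub_pos.2 hM2)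
  filter_upwards [h4.eventually (gt_mem_nhds hM1), (hnx _ hx).eventually h3,
    (hnx _ hxη).eventually h3, (h5.eventually ((h2 _ hlog).eventually_ge_atTop (Real.log 2))),
    tendsto_log_natCast_atTop.eventually_gt_atTop 0, h6.eventually_ge_atTop (Real.log 2),
    eventually_gt_atTop 0] with n e1 e2 e3 e4 e5 e6 hn
  have hn' : (0 : ℝ) < n := by exact_mod_cast hn
  have e7 : Real.log (n * x) + Real.log ((x + η) / x) = Real.log (n * (x + η)) := by
    rw [← Real.log_mul (by positivity) (by positivity)]
    congr 1
    field_simp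
  rw [e7] at e4
  rw [div_lt_iff₀ (Real.rpow_pos_of_pos e5 γ)] at e1
  have hle : (n : ℝ) * x ≤ n * (x + η) := by gcongr; linarith
  have e8 : ρ.real (Ioc ((n : ℝ) * x) (n * (x + η))) =
      Real.exp (-r (Real.log (n * x))) - Real.exp (-r (Real.log (n * (x + η)))) := by
    rw [← e2, ← e3, ← Ioi_sdiff_Ioi, measureReal_sdiff (Ioi_subset_Ioi hle) measurableSet_Ioi]
  have e9 : 2 * Real.exp (-r (Real.log (n * (x + η)))) ≤ Real.exp (-r (Real.log (n * x))) := by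
    rw [← Real.exp_log (zero_lt_two' ℝ), ← Real.exp_add, Real.exp_le_exp]
    linarith
  have e10 : 2 * Real.exp (-M * Real.log n ^ γ) ≤ Real.exp (-r (Real.log (n * x))) := by
    rw [← Real.exp_log (zero_lt_two' ℝ), ← Real.exp_add, Real.exp_le_exp]
    linarith
  rw [e8]
  linarith

theorem integrable_id [IsProbabilityMeasure ρ] (h : IsLognormalType ρ γ lam) (hγ : 1 < γ)
    (hlam : 0 < lam) : Integrable (fun x : ℝ => x) ρ := by
  obtain ⟨r, h1, -, h3⟩ := h.exists_real_tail
  -- Since `γ > 1`, the bound `r y ≥ (lam / 2) * y ^ γ` beats `2 * y` once `y ^ (γ - 1) ≥ 4 / lam`.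
  -- The tail is then at most `x ^ (-2)`, which is integrable at infinity.
  have hr : ∀ᶠ y in atTop, 2 * y ≤ r y := by
    filter_upwards [h1.eventually (lt_mem_nhds (half_lt_self hlam)), eventually_gt_atTop 0,
      (tendsto_rpow_atTop (sub_pos.2 hγ)).eventually_ge_atTop (4 / lam)] with y e1 e2 e3
    rw [lt_div_iff₀ (Real.rpow_pos_of_pos e2 γ)] at e1
    rw [Real.rpow_sub_one e2.ne', div_le_div_iff₀ hlam e2] at e3
    nlinarith
  have hb : ∀ᶠ x in atTop, ρ.real (Ioi x) ≤ x ^ (-2 : ℝ) := by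
    filter_upwards [h3, Real.tendsto_log_atTop.eventually hr, eventually_gt_atTop 0]
      with x e1 e2 e3
    rw [e1, Real.rpow_def_of_pos e3, Real.exp_le_exp]
    linarith
  obtain ⟨A, hA⟩ := eventually_atTop.1 hb
  set B := max A 1
  have hB : 0 < B := lt_of_lt_of_le one_pos (le_max_right _ _)
  refine ⟨by fun_prop, ?_⟩
  rw [hasFiniteIntegral_iff_ofReal h.nonneg,
    lintegral_eq_lintegral_meas_lt ρ h.nonneg (by fun_prop), ← Ioc_union_Ioi_eq_Ioi hB.le]
  refine (lintegral_union_le _ _ _).trans_lt (ENNReal.add_lt_top.2 ⟨?_, ?_⟩)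
  · calc ∫⁻ t in Ioc 0 B, ρ {a | t < a} ≤ ∫⁻ _ in Ioc 0 B, 1 :=
          lintegral_mono fun _ => prob_le_one
      _ < ∞ := by simp
  · have hint := integrableOn_Ioi_rpow_of_lt (show (-2 : ℝ) < -1 by norm_num) hB
    refine lt_of_le_of_lt ?_ hint.lintegral_lt_top
    refine setLIntegral_mono' measurableSet_Ioi fun t (ht : B < t) => ?_
    rw [← ofReal_measureReal (by finiteness)]
    exact ENNReal.ofReal_le_ofReal (hA t ((le_max_left _ _).trans ht.le))

theorem tendsto_integral_truncAbove [IsProbabilityMeasure ρ] (h : IsLognormalType ρ γ lam)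
    (hγ : 1 < γ) (hlam : 0 < lam) {b : ℕ → ℝ} (hb : Tendsto b atTop atTop) :
    Tendsto (fun n => ∫ x, truncAbove (b n) x ∂ρ) atTop (𝓝 (∫ x, x ∂ρ)) := by
  refine tendsto_integral_of_dominated_convergence (fun x => |x|)
    (fun n => (measurable_truncAbove _).aestronglyMeasurable) (h.integrable_id hγ hlam).abs
    (fun n => ae_of_all _ fun x => ?_) (ae_of_all _ fun x => ?_)
  · rw [truncAbove]
    split_ifs <;> simp
  · refine tendsto_const_nhds.congr' ?_
    filter_upwards [hb.eventually_ge_atTop x] with n hn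
    rw [truncAbove, if_pos hn]

end IsLognormalType

/-! ### Sums of truncated variables and counts of large variables -/

section Walk

variable {Ω : Type*} [MeasurableSpace Ω] {P : Measure Ω}

/-- A maximal form of Hoeffding's inequality, by the union bound. -/
theorem real_exists_abs_sum_range_ge_le [IsProbabilityMeasure P] {X : ℕ → Ω → ℝ}
    (hX : iIndepFun X P) {c : NNReal}
    (hc : 0 < c) (hsub : ∀ j, HasSubgaussianMGF (X j) c P) {a : ℝ} (ha : 0 < a) (n : ℕ) :
    P.real {ω | ∃ k ≤ n, a ≤ |∑ j ∈ Finset.range k, X j ω|} ≤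
      (n + 1) * (2 * Real.exp (-a ^ 2 / (2 * n * c))) := by
  have hX' : iIndepFun (fun j => -X j) P :=
    hX.comp (fun _ x => -x) fun _ => measurable_neg
  have hle : ∀ k ∈ Finset.range (n + 1), P.real {ω | a ≤ |∑ j ∈ Finset.range k, X j ω|} ≤
      2 * Real.exp (-a ^ 2 / (2 * n * c)) := by
    intro k hk
    rcases Nat.eq_zero_or_pos k with rfl | hk0
    · have : {ω : Ω | a ≤ |∑ j ∈ Finset.range 0, X j ω|} = ∅ := by
        ext; simpa using ha
      rw [this, measureReal_empty]
      positivity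
    have hk0' : (0 : ℝ) < k := by exact_mod_cast hk0
    have hkn : (k : ℝ) ≤ n := by exact_mod_cast Nat.lt_succ_iff.1 (Finset.mem_range.1 hk)
    have hc' : (0 : ℝ) < c := by exact_mod_cast hc
    have hexp : Real.exp (-a ^ 2 / (2 * k * c)) ≤ Real.exp (-a ^ 2 / (2 * n * c)) := by
      rw [Real.exp_le_exp, neg_div, neg_div, neg_le_neg_iff]
      gcongr
    have h1 := HasSubgaussianMGF.measure_sum_range_ge_le_of_iIndepFun (n := k) hX
      (fun j _ => hsub j) ha.le
    have h2 := HasSubgaussianMGF.measure_sum_range_ge_le_of_iIndepFun (n := k) hX'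
      (fun j _ => (hsub j).neg) ha.le
    have hsubset : {ω | a ≤ |∑ j ∈ Finset.range k, X j ω|} ⊆
        {ω | a ≤ ∑ j ∈ Finset.range k, X j ω} ∪ {ω | a ≤ ∑ j ∈ Finset.range k, (-X j) ω} := by
      intro ω (hω : a ≤ |_|)
      simpa [le_abs] using hω
    have h3 := (measureReal_mono hsubset (μ := P)).trans (measureReal_union_le _ _)
    linarith
  have hsubset : {ω | ∃ k ≤ n, a ≤ |∑ j ∈ Finset.range k, X j ω|} ⊆
      ⋃ k ∈ Finset.range (n + 1), {ω | a ≤ |∑ j ∈ Finset.range k, X j ω|} := by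
    rintro ω ⟨k, hk, hω⟩
    exact mem_biUnion (Finset.mem_coe.2 (Finset.mem_range.2 (Nat.lt_succ_iff.2 hk))) hω
  refine (measureReal_mono hsubset (measure_ne_top _ _)).trans ((measureReal_biUnion_finset_le _ _).trans ?_)
  refine (Finset.sum_le_card_nsmul _ _ _ hle).trans_eq ?_
  rw [Finset.card_range, nsmul_eq_mul]
  push_cast
  rfl

/-- The level `n ^ (1 / 4)` at which the increments are truncated. -/
noncomputable def truncLevel (n : ℕ) : ℝ := (n : ℝ) ^ (1 / 4 : ℝ)

theorem truncLevel_nonneg (n : ℕ) : 0 ≤ truncLevel n := by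
  unfold truncLevel
  positivity

theorem tendsto_truncLevel : Tendsto truncLevel atTop atTop :=
  (tendsto_rpow_atTop (by norm_num)).comp tendsto_natCast_atTop_atTop

theorem eventually_truncLevel_le {x : ℝ} (hx : 0 < x) : ∀ᶠ n : ℕ in atTop, truncLevel n ≤ n * x := by
  have h := (tendsto_rpow_atTop (show (0 : ℝ) < 3 / 4 by norm_num)).comp
    tendsto_natCast_atTop_atTop
  filter_upwards [h.eventually_ge_atTop (1 / x), eventually_gt_atTop 0] with n hn h0
  have h0' : (0 : ℝ) < n := by exact_mod_cast h0
  have : (n : ℝ) = truncLevel n * (n : ℝ) ^ (3 / 4 : ℝ) := by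
    rw [truncLevel, ← Real.rpow_add h0']
    norm_num
  rw [Function.comp_apply, div_le_iff₀ hx] at hn
  calc truncLevel n = truncLevel n * 1 := (mul_one _).symm
    _ ≤ truncLevel n * ((n : ℝ) ^ (3 / 4 : ℝ) * x) :=
        mul_le_mul_of_nonneg_left hn (truncLevel_nonneg n)
    _ = n * x := by rw [← mul_assoc, ← this]

/-- The event that some centered partial sum of the truncated increments exceeds `n * ε`. -/
def truncSumLarge (P : Measure Ω) (X : ℕ → Ω → ℝ) (ε : ℝ) (n : ℕ) : Set Ω :=
  {ω | ∃ k ≤ n, n * ε <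
    |∑ j ∈ Finset.range k, (truncAbove (truncLevel n) (X j ω) - ∫ ω', X 0 ω' ∂P)|}

/-- The truncated increments lie in `[0, n ^ (1 / 4)]`, so Hoeffding's inequality at deviation `n *
ε / 2` has exponent of order `n ^ (1 / 2)`; a truncation exponent below `1 / 2` keeps this a
positive power. The other `ε / 2` pays for centering at the full mean instead of the truncated one.
-/
theorem decaysAt_truncSumLarge [IsProbabilityMeasure P] {X : ℕ → Ω → ℝ} {γ lam : ℝ} (hγ : 1 < γ)
    (hlam : 0 < lam) (hX : ∀ j, Measurable (X j)) (hindep : iIndepFun X P)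
    (hident : ∀ j, IdentDistrib (X j) (X 0) P P) (htail : IsLognormalType (P.map (X 0)) γ lam)
    {ε : ℝ} (hε : 0 < ε) (M : ℝ) :
    DecaysAt γ M fun n => P.real (truncSumLarge P X ε n) := by
  have hprob : IsProbabilityMeasure (P.map (X 0)) :=
    Measure.isProbabilityMeasure_map (hX 0).aemeasurable
  set m : ℕ → ℝ := fun n => ∫ ω, truncAbove (truncLevel n) (X 0 ω) ∂P
  have hm : Tendsto m atTop (𝓝 (∫ ω, X 0 ω ∂P)) := by
    have h := htail.tendsto_integral_truncAbove hγ hlam tendsto_truncLevel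
    rw [integral_map (hX 0).aemeasurable (by fun_prop)] at h
    refine h.congr fun n => ?_
    rw [integral_map (hX 0).aemeasurable (measurable_truncAbove _).aestronglyMeasurable]
  have hmj : ∀ n j, ∫ ω, truncAbove (truncLevel n) (X j ω) ∂P = m n := fun n j =>
    ((hident j).comp (measurable_truncAbove _)).integral_eq
  have hnn : ∀ j, ∀ᵐ ω ∂P, 0 ≤ X j ω := fun j =>
    (hident j).symm.ae_snd measurableSet_Ici (ae_of_ae_map (hX 0).aemeasurable htail.nonneg)
  -- The factor `n * n` dominates the union-bound constant `2 * (n + 1)` as soon as `n ≥ 3`.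
  have hbound : ∀ᶠ n : ℕ in atTop, P.real (truncSumLarge P X ε n) ≤
      ((n : ℝ) * n) * Real.exp (-(ε ^ 2 / 2 * (n : ℝ) ^ (1 / 2 : ℝ))) := by
    filter_upwards [hm.eventually (Metric.ball_mem_nhds _ (half_pos hε)), eventually_ge_atTop 3]
      with n hmn hn
    have hn0 : (0 : ℝ) < n := by exact_mod_cast (by omega : 0 < n)
    have hn3 : (3 : ℝ) ≤ n := by exact_mod_cast hn
    have hb : 0 < truncLevel n := Real.rpow_pos_of_pos hn0 _
    set Y : ℕ → Ω → ℝ := fun j ω => truncAbove (truncLevel n) (X j ω) - m n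
    have hY : iIndepFun Y P := hindep.comp (fun _ x => truncAbove (truncLevel n) x - m n)
      fun _ => (measurable_truncAbove _).sub_const _
    have hsub : ∀ j, HasSubgaussianMGF (Y j) ((‖truncLevel n - 0‖₊ / 2) ^ 2) P := by
      intro j
      have := hasSubgaussianMGF_of_mem_Icc (μ := P)
        (X := fun ω => truncAbove (truncLevel n) (X j ω)) (a := 0) (b := truncLevel n)
        ((measurable_truncAbove _).comp (hX j)).aemeasurable (by
          filter_upwards [hnn j] with ω hω
          rw [truncAbove]
          split_ifs with h
          · exact ⟨hω, h⟩
          · exact ⟨le_rfl, hb.le⟩)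
      rwa [hmj] at this
    have hc : (0 : NNReal) < (‖truncLevel n - 0‖₊ / 2) ^ 2 := by
      have : (0 : NNReal) < ‖truncLevel n - 0‖₊ := by simpa using hb.ne'
      positivity
    have hmain := real_exists_abs_sum_range_ge_le hY hc hsub
      (show 0 < (n : ℝ) * (ε / 2) by positivity) n
    have hexp : -((n : ℝ) * (ε / 2)) ^ 2 /
        (2 * n * (((‖truncLevel n - 0‖₊ / 2) ^ 2 : NNReal) : ℝ)) =
        -(ε ^ 2 / 2 * (n : ℝ) ^ (1 / 2 : ℝ)) := by
      have h1 : (((‖truncLevel n - 0‖₊ / 2) ^ 2 : NNReal) : ℝ) = (n : ℝ) ^ (1 / 2 : ℝ) / 4 := by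
        push_cast
        rw [sub_zero, Real.norm_of_nonneg hb.le, div_pow, truncLevel, ← Real.rpow_natCast,
          ← Real.rpow_mul hn0.le]
        norm_num
      have h2 : (n : ℝ) = (n : ℝ) ^ (1 / 2 : ℝ) * (n : ℝ) ^ (1 / 2 : ℝ) := by
        rw [← Real.rpow_add hn0]
        norm_num
      have h3 : 0 < (n : ℝ) ^ (1 / 2 : ℝ) := Real.rpow_pos_of_pos hn0 _
      rw [h1]
      set u := (n : ℝ) ^ (1 / 2 : ℝ)
      rw [h2]
      field_simp
      ring
    rw [hexp] at hmain
    refine (measureReal_mono ?_).trans (hmain.trans ?_)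
    · rintro ω ⟨k, hk, hω⟩
      refine ⟨k, hk, ?_⟩
      set μ := ∫ ω', X 0 ω' ∂P
      have hkn : (k : ℝ) ≤ n := by exact_mod_cast hk
      have hdiff : ∑ j ∈ Finset.range k, (truncAbove (truncLevel n) (X j ω) - μ) =
          ∑ j ∈ Finset.range k, Y j ω + k * (m n - μ) := by
        simp only [Y, Finset.sum_sub_distrib, Finset.sum_const, Finset.card_range, nsmul_eq_mul]
        ring
      rw [hdiff] at hω
      have h1 := abs_add_le (∑ j ∈ Finset.range k, Y j ω) (k * (m n - μ))
      have h2 : |(k : ℝ) * (m n - μ)| ≤ n * (ε / 2) := by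
        rw [abs_mul, Nat.abs_cast]
        have : |m n - μ| ≤ ε / 2 := by
          rw [← Real.dist_eq]; exact (Metric.mem_ball.1 hmn).le
        gcongr
      linarith
    · rw [← mul_assoc]
      refine mul_le_mul_of_nonneg_right ?_ (Real.exp_pos _).le
      nlinarith
  have h0 := (DecaysAt.natCast hγ).mul (fun n => n.cast_nonneg) (DecaysAt.natCast hγ)
  have h1 := h0.mul (fun n => (Real.exp_pos _).le)
    (DecaysAt.exp_neg_rpow (M := M) (show 0 < ε ^ 2 / 2 by positivity)
      (show (0 : ℝ) < 1 / 2 by norm_num))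
  simp only [add_zero, zero_add] at h1
  exact h1.mono hbound

/-! ### Independence and the number of large increments. -/

variable {d : ℕ} {Z : Fin d → ℕ → Ω → ℝ}

theorem real_iInter_preimage_eq_prod [IsProbabilityMeasure P]
    (hindep : iIndepFun (fun p : Fin d × ℕ => Z p.1 p.2) P)
    (hZ : ∀ i j, Measurable (Z i j)) (hident : ∀ i j, IdentDistrib (Z i j) (Z i 0) P P)
    (T : Fin d → Finset ℕ) {s : Fin d → ℕ → Set ℝ} (hs : ∀ i j, MeasurableSet (s i j)) :
    P.real {ω | ∀ i, ∀ j ∈ T i, Z i j ω ∈ s i j} =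
      ∏ i, ∏ j ∈ T i, (P.map (Z i 0)).real (s i j) := by
  classical
  set S : Finset (Fin d × ℕ) := Finset.univ.biUnion fun i => (T i).image fun j => (i, j)
  have hS : ∀ p, p ∈ S ↔ p.1 ∈ (Finset.univ : Finset (Fin d)) ∧ p.2 ∈ T p.1 := by
    rintro ⟨i, j⟩
    simp [S]
  have h := hindep.measure_inter_preimage_eq_mul S (sets := fun p => s p.1 p.2)
    fun p _ => hs p.1 p.2
  have hset : {ω | ∀ i, ∀ j ∈ T i, Z i j ω ∈ s i j} =
      ⋂ p ∈ S, (fun ω => Z p.1 p.2 ω) ⁻¹' s p.1 p.2 := by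
    ext ω
    simp [hS]
  rw [measureReal_def, hset, h, ENNReal.toReal_prod, ← Finset.prod_finset_product S _ T hS
    (f := fun p => (P.map (Z p.1 0)).real (s p.1 p.2))]
  refine Finset.prod_congr rfl fun p _ => ?_
  rw [measureReal_def, Measure.map_apply (hZ _ _) (hs _ _)]
  exact congrArg _ ((hident p.1 p.2).measure_mem_eq (hs _ _))

/-- The number of the first `n` increments that exceed `c`. -/
noncomputable def countAbove (z : ℕ → ℝ) (c : ℝ) (n : ℕ) : ℕ :=
  ((Finset.range n).filter fun j => c < z j).card

/-- A union bound over the sets of `k i` indices at which the level is exceeded; there are at most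
`n ^ k i` of them in coordinate `i`. -/
theorem real_le_countAbove_le [IsProbabilityMeasure P]
    (hindep : iIndepFun (fun p : Fin d × ℕ => Z p.1 p.2) P)
    (hZ : ∀ i j, Measurable (Z i j)) (hident : ∀ i j, IdentDistrib (Z i j) (Z i 0) P P)
    (k : Fin d → ℕ) (c : Fin d → ℝ) (n : ℕ) :
    P.real {ω | ∀ i, k i ≤ countAbove (fun j => Z i j ω) (c i) n} ≤
      ∏ i, ((n : ℝ) * (P.map (Z i 0)).real (Ioi (c i))) ^ k i := by
  classical
  set 𝒯 := Fintype.piFinset fun i => (Finset.range n).powersetCard (k i)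
  have hsub : {ω | ∀ i, k i ≤ countAbove (fun j => Z i j ω) (c i) n} ⊆
      ⋃ T ∈ 𝒯, {ω | ∀ i, ∀ j ∈ T i, Z i j ω ∈ Ioi (c i)} := by
    intro ω hω
    choose T hT hTc using fun i => Finset.exists_subset_card_eq (hω i)
    refine mem_biUnion (x := T) ?_ fun i j hj => (Finset.mem_filter.1 (hT i hj)).2
    exact Finset.mem_coe.2 (Fintype.mem_piFinset.2 fun i => Finset.mem_powersetCard.2
      ⟨(hT i).trans (Finset.filter_subset _ _), hTc i⟩)
  have hle : ∀ T ∈ 𝒯, P.real {ω | ∀ i, ∀ j ∈ T i, Z i j ω ∈ Ioi (c i)} ≤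
      ∏ i, (P.map (Z i 0)).real (Ioi (c i)) ^ k i := by
    intro T hT
    rw [real_iInter_preimage_eq_prod hindep hZ hident T fun _ _ => measurableSet_Ioi]
    refine (Finset.prod_congr rfl fun i _ => ?_).le
    rw [Finset.prod_const, (Finset.mem_powersetCard.1 (Fintype.mem_piFinset.1 hT i)).2]
  refine (measureReal_mono hsub (measure_ne_top _ _)).trans ((measureReal_biUnion_finset_le _ _).trans ?_)
  refine (Finset.sum_le_card_nsmul _ _ _ hle).trans ?_
  rw [Fintype.card_piFinset, nsmul_eq_mul]
  push_cast
  rw [← Finset.prod_mul_distrib]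
  refine Finset.prod_le_prod (fun i _ => by positivity) fun i _ => ?_
  rw [mul_pow, Finset.card_powersetCard, Finset.card_range]
  gcongr
  refine (Nat.choose_le_pow_div (k i) n).trans (div_le_self (by positivity) ?_)
  exact_mod_cast Nat.one_le_iff_ne_zero.2 (Nat.factorial_ne_zero _)

theorem decaysAt_le_countAbove [IsProbabilityMeasure P] {γ : ℝ} (hγ : 1 < γ)
    (hindep : iIndepFun (fun p : Fin d × ℕ => Z p.1 p.2) P)
    (hZ : ∀ i j, Measurable (Z i j)) (hident : ∀ i j, IdentDistrib (Z i j) (Z i 0) P P)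
    (k : Fin d → ℕ) {c : ℕ → ℝ} {M : Fin d → ℝ}
    (hM : ∀ i, DecaysAt γ (M i) fun n => (P.map (Z i 0)).real (Ioi (c n))) :
    DecaysAt γ (∑ i, k i * M i) fun n =>
      P.real {ω | ∀ i, k i ≤ countAbove (fun j => Z i j ω) (c n) n} := by
  have hγ0 : 0 < γ := by linarith
  refine (DecaysAt.prod hγ0 Finset.univ (fun i _ n => by positivity) fun i _ =>
    DecaysAt.pow hγ0 (k i) (fun n => by positivity)
      (p := fun n => (n : ℝ) * (P.map (Z i 0)).real (Ioi (c n))) ?_).mono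
    (Eventually.of_forall fun n => real_le_countAbove_le hindep hZ hident k (fun _ => c n) n)
  simpa using (DecaysAt.natCast hγ).mul (fun n => measureReal_nonneg) (hM i)

end Walk

/-! ### The upper bound -/

/-- Split the increments at `truncLevel n` and `n * δ`. The small ones, with all the centering, form
the sum in `hsum`; at most `m` intermediate ones contribute at most `n * δ` each; the large ones
cancel. -/
theorem edist_scaledPath_sub_const_le {n m : ℕ} {z : ℕ → ℝ} {μ ε δ : ℝ} (hε : 0 ≤ ε)
    (hδ : 0 ≤ δ) (hb : truncLevel n ≤ n * δ)
    (hsum : ∀ k ≤ n, |∑ j ∈ Finset.range k, (truncAbove (truncLevel n) (z j) - μ)| ≤ n * ε)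
    (hcount : countAbove z (truncLevel n) n ≤ m) :
    edist (scaledPath n fun j => z j - μ)
      (scaledPath n fun j => if n * δ < z j then z j else 0) ≤ ENNReal.ofReal (ε + m * δ) := by
  refine edist_scaledPath_le (by positivity) fun k hk => ?_
  have hj : ∀ j, z j - μ - (if n * δ < z j then z j else 0) =
      (truncAbove (truncLevel n) (z j) - μ) +
        (if truncLevel n < z j ∧ z j ≤ n * δ then z j else 0) := by
    intro j
    rw [truncAbove]
    by_cases h1 : z j ≤ truncLevel n
    · rw [if_pos h1, if_neg (h1.trans hb).not_gt, if_neg fun h => h.1.not_ge h1]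
      ring
    · by_cases h2 : z j ≤ n * δ
      · rw [if_neg h1, if_neg h2.not_gt, if_pos ⟨not_le.1 h1, h2⟩]
        ring
      · rw [if_neg h1, if_pos (not_le.1 h2), if_neg fun h => h2 h.2]
        ring
  simp only [hj]
  rw [Finset.sum_add_distrib]
  refine (abs_add_le _ _).trans ?_
  rw [mul_add]
  refine add_le_add (hsum k hk) ((Finset.abs_sum_le_sum_abs _ _).trans ?_)
  have hle : ∀ j ∈ Finset.range k, |if truncLevel n < z j ∧ z j ≤ n * δ then z j else 0| ≤
      if truncLevel n < z j then n * δ else 0 := by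
    intro j _
    by_cases h1 : truncLevel n < z j
    · rw [if_pos h1]
      split_ifs with h2
      · rw [abs_of_nonneg ((truncLevel_nonneg n).trans h1.le)]
        exact h2.2
      · simpa using (truncLevel_nonneg n).trans hb
    · simp [h1]
  refine (Finset.sum_le_sum hle).trans ?_
  rw [← Finset.sum_filter, Finset.sum_const, nsmul_eq_mul]
  have hcard : (((Finset.range k).filter fun j => truncLevel n < z j).card : ℝ) ≤ m := by
    refine Nat.cast_le.2 (le_trans (Finset.card_le_card ?_) hcount)
    exact Finset.filter_subset_filter _ (Finset.range_subset_range.2 hk)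
  calc _ ≤ (m : ℝ) * (n * δ) := by gcongr
    _ = n * (m * δ) := by ring

/-- The vector of scaled paths that keep only the increments above `c`. -/
noncomputable def bigJumpPath {d : ℕ} (n : ℕ) (z : Fin d → ℕ → ℝ) (c : ℝ) : SkorokhodProd d :=
  fun i => scaledPath n fun j => if c < z i j then z i j else 0

theorem multiRate_bigJumpPath_le {d n : ℕ} {lam : Fin d → ℝ} (hlam : ∀ i, 0 < lam i)
    (z : Fin d → ℕ → ℝ) {c : ℝ} (hc : 0 ≤ c) :
    multiRate lam (bigJumpPath n z c) ≤
      ENNReal.ofReal (∑ i, countAbove (z i) c n * lam i) := by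
  rw [multiRate_eq_sum hlam, ENNReal.ofReal_sum_of_nonneg fun i _ =>
    mul_nonneg (Nat.cast_nonneg _) (hlam i).le]
  refine Finset.sum_le_sum fun i _ => ?_
  rw [mul_comm (countAbove (z i) c n : ℝ), ENNReal.ofReal_mul (hlam i).le, ENNReal.ofReal_natCast]
  gcongr
  have h := jumpCount_scaledPath_le (n := n) (w := fun j => if c < z i j then z i j else 0)
    fun j _ => by
      split_ifs with h
      · exact hc.trans h.le
      · exact le_rfl
  have h2 : ((Finset.range n).filter fun j => (if c < z i j then z i j else 0) ≠ 0).card ≤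
      countAbove (z i) c n := by
    refine Finset.card_le_card (Finset.monotone_filter_right _ fun j _ hj => ?_)
    by_contra hne
    exact hj (if_neg hne)
  have h3 : (bigJumpPath n z c i).jumpCount ≤ _ := h.trans (Nat.cast_le.2 h2)
  rw [← ENat.toENNReal_coe]
  exact ENat.toENNReal_mono h3

section Walk

variable {Ω : Type*} [MeasurableSpace Ω] {P : Measure Ω} {d : ℕ} {Z : Fin d → ℕ → Ω → ℝ}

theorem decaysAt_scaledWalk_mem [IsProbabilityMeasure P] {γ : ℝ} (hγ : 1 < γ)
    {lam : Fin d → ℝ} (hlam : ∀ i, 0 < lam i) (hZ : ∀ i j, Measurable (Z i j))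
    (hindep : iIndepFun (fun p : Fin d × ℕ => Z p.1 p.2) P)
    (hident : ∀ i j, IdentDistrib (Z i j) (Z i 0) P P)
    (htail : ∀ i, IsLognormalType (P.map (Z i 0)) γ (lam i)) {F : Set (SkorokhodProd d)}
    {ε : ℝ} (hε : 0 < ε) {M : ℝ}
    (hM : ∀ ξ ∈ Metric.cthickening ε F, ENNReal.ofReal M ≤ multiRate lam ξ) :
    DecaysAt γ M fun n => P.real (scaledWalk P Z n ⁻¹' F) := by
  classical
  have hγ0 : 0 < γ := by linarith
  have hprob : ∀ i, IsProbabilityMeasure (P.map (Z i 0)) := fun i =>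
    Measure.isProbabilityMeasure_map (hZ i 0).aemeasurable
  -- The error allowed per coordinate; `d + 1` instead of `d` covers `d = 0`.
  set e : ℝ := ε / (d + 1)
  have he : 0 < e := by positivity
  -- An increment above `n ^ (1 / 4)` costs `lam i * (1 / 4) ^ γ`, so `m` of them already cost `M`
  -- and may be excluded.
  obtain ⟨m, hm1, hmM⟩ : ∃ m : ℕ, 0 < m ∧ ∀ i, M ≤ m * (lam i * (1 / 4 : ℝ) ^ γ) := by
    have h : ∀ᶠ m : ℕ in atTop, ∀ i, M ≤ m * (lam i * (1 / 4 : ℝ) ^ γ) := by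
      refine eventually_all.2 fun i => ?_
      exact (tendsto_natCast_atTop_atTop.atTop_mul_const (mul_pos (hlam i)
        (Real.rpow_pos_of_pos (by norm_num) γ))).eventually_ge_atTop M
    exact ((eventually_gt_atTop 0).and h).exists
  have hm1' : (0 : ℝ) < m := by exact_mod_cast hm1
  -- Chosen so that the intermediate increments contribute at most `m * δ = e / 2`.
  set δ : ℝ := e / (2 * m)
  have hδ : 0 < δ := by positivity
  set K : Finset (Fin d → ℕ) :=
    (Fintype.piFinset fun _ => Finset.range (m + 1)).filter fun k => M ≤ ∑ i, k i * lam i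
  have h1 : ∀ i, DecaysAt γ M fun n => P.real (truncSumLarge P (Z i) (e / 2) n) := fun i =>
    decaysAt_truncSumLarge hγ (hlam i) (hZ i)
      (hindep.precomp (g := fun j : ℕ => (i, j)) fun a b h => (Prod.mk.inj h).2)
      (hident i) (htail i) (half_pos he) M
  have h2 : ∀ i, DecaysAt γ M fun n =>
      P.real {ω | m ≤ countAbove (fun j => Z i j ω) (truncLevel n) n} := by
    intro i
    -- `Pi.single` constrains coordinate `i` only; the other coordinates need count at least `0`.
    have h := decaysAt_le_countAbove hγ hindep hZ hident (Pi.single i m)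
      (c := truncLevel) fun i => (htail i).decaysAt_tail_rpow (a := 1 / 4) (by norm_num)
    have hsum : ∑ i', ((Pi.single i m : Fin d → ℕ) i' : ℝ) * (lam i' * (1 / 4 : ℝ) ^ γ) =
        m * (lam i * (1 / 4 : ℝ) ^ γ) := by
      rw [Finset.sum_eq_single_of_mem i (Finset.mem_univ i) fun b _ hb => by simp [hb]]
      simp
    rw [hsum] at h
    refine (h.anti (hmM i)).mono (Eventually.of_forall fun n => measureReal_mono fun ω hω i' => ?_)
    by_cases hi : i' = i
    · subst hi
      simpa using hω
    · simp [hi]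
  have h3 : ∀ k ∈ K, DecaysAt γ M fun n =>
      P.real {ω | ∀ i, k i ≤ countAbove (fun j => Z i j ω) (n * δ) n} := fun k hk =>
    (decaysAt_le_countAbove hγ hindep hZ hident k fun i => (htail i).decaysAt_tail_mul hδ).anti
      (Finset.mem_filter.1 hk).2
  have htotal := ((DecaysAt.sum hγ0 Finset.univ fun i _ => h1 i).add hγ0
    (DecaysAt.sum hγ0 Finset.univ fun i _ => h2 i)).add hγ0 (DecaysAt.sum hγ0 K h3)
  refine htotal.mono ?_
  filter_upwards [eventually_truncLevel_le hδ] with n hn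
  have hsub : scaledWalk P Z n ⁻¹' F ⊆
      ((⋃ i ∈ (Finset.univ : Finset (Fin d)), truncSumLarge P (Z i) (e / 2) n) ∪
        ⋃ i ∈ (Finset.univ : Finset (Fin d)),
          {ω | m ≤ countAbove (fun j => Z i j ω) (truncLevel n) n}) ∪
        ⋃ k ∈ K, {ω | ∀ i, k i ≤ countAbove (fun j => Z i j ω) (n * δ) n} := by
    intro ω hω
    by_contra hnot
    simp only [mem_union, mem_iUnion, not_or, not_exists, Finset.mem_univ,
      mem_ofPred_eq, not_le, truncSumLarge, not_and, not_lt, forall_const] at hnot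
    obtain ⟨⟨n1, n2⟩, n3⟩ := hnot
    set ζ : SkorokhodProd d := bigJumpPath n (fun i j => Z i j ω) (n * δ)
    have hd : ∀ i, edist (scaledWalk P Z n ω i) (ζ i) ≤ ENNReal.ofReal e := by
      intro i
      have := edist_scaledPath_sub_const_le (half_pos he).le hδ.le hn (n1 i) (n2 i).le
      refine this.trans_eq ?_
      congr 1
      simp only [δ]
      field_simp
      ring
    have hζ : ζ ∈ Metric.cthickening ε F := by
      rw [Metric.mem_cthickening_iff]
      refine (Metric.infEDist_le_edist_of_mem (mem_preimage.1 hω)).trans ?_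
      rw [edist_comm]
      calc edist (scaledWalk P Z n ω) ζ ≤ ∑ _i : Fin d, ENNReal.ofReal e :=
            Finset.sum_le_sum fun i _ => hd i
        _ = ENNReal.ofReal (d * e) := by
            rw [Finset.sum_const, Finset.card_univ, Fintype.card_fin, nsmul_eq_mul,
              ENNReal.ofReal_mul (Nat.cast_nonneg _), ENNReal.ofReal_natCast]
        _ ≤ ENNReal.ofReal ε := by
            refine ENNReal.ofReal_le_ofReal ?_
            simp only [e]
            rw [mul_div_assoc', div_le_iff₀ (by positivity)]
            nlinarith
    have hrate := (hM ζ hζ).trans (multiRate_bigJumpPath_le hlam (fun i j => Z i j ω)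
      (show (0 : ℝ) ≤ n * δ by positivity))
    rw [ENNReal.ofReal_le_ofReal_iff (Finset.sum_nonneg fun i _ =>
      mul_nonneg (Nat.cast_nonneg _) (hlam i).le)] at hrate
    -- The observed count vector itself belongs to `K`, which contradicts `n3`.
    refine n3 (fun i => countAbove (fun j => Z i j ω) (n * δ) n) ?_ fun i => le_rfl
    refine Finset.mem_filter.2 ⟨Fintype.mem_piFinset.2 fun i => Finset.mem_range.2 ?_, hrate⟩
    have : countAbove (fun j => Z i j ω) (n * δ) n ≤
        countAbove (fun j => Z i j ω) (truncLevel n) n :=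
      Finset.card_le_card (Finset.monotone_filter_right _ fun j _ hj => hn.trans_lt hj)
    have := n2 i
    omega
  refine (measureReal_mono hsub (measure_ne_top _ _)).trans ((measureReal_union_le _ _).trans ?_)
  exact add_le_add ((measureReal_union_le _ _).trans (add_le_add
    (measureReal_biUnion_finset_le _ _) (measureReal_biUnion_finset_le _ _)))
    (measureReal_biUnion_finset_le _ _)

end Walk

/-! ### The lower bound -/

/-- Truncation kills the increments at the chosen indices and leaves all others unchanged. Besides
the truncated sum, each chosen index thus leaves only its overshoot `z - n * x`, at most `n * η`. -/
theorem edist_scaledPath_step_le {n : ℕ} {z : ℕ → ℝ} {μ ε η : ℝ} {J : Finset I} {x : I → ℝ}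
    (hε : 0 ≤ ε) (hη : 0 ≤ η) (hinj : InjOn (jumpIndex n) J)
    (hx : ∀ t ∈ J, truncLevel n ≤ n * x t)
    (hsum : ∀ k ≤ n, |∑ j ∈ Finset.range k, (truncAbove (truncLevel n) (z j) - μ)| ≤ n * ε)
    (hJ : ∀ t ∈ J, z (jumpIndex n t) ∈ Ioc (n * x t) (n * (x t + η)))
    (hz : ∀ j < n, (∀ t ∈ J, jumpIndex n t ≠ j) → z j ≤ truncLevel n) :
    edist (scaledPath n fun j => z j - μ)
      (scaledPath n fun j => n * ∑ t ∈ J, if jumpIndex n t = j then x t else 0) ≤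
        ENNReal.ofReal (ε + J.card * η) := by
  refine edist_scaledPath_le (by positivity) fun k hk => ?_
  have hj : ∀ j ∈ Finset.range k, z j - μ - n * ∑ t ∈ J, (if jumpIndex n t = j then x t else 0) =
      (truncAbove (truncLevel n) (z j) - μ) +
        ∑ t ∈ J, if jumpIndex n t = j then z (jumpIndex n t) - n * x t else 0 := by
    intro j hjk
    have hjn : j < n := (Finset.mem_range.1 hjk).trans_le hk
    by_cases h : ∃ t ∈ J, jumpIndex n t = j
    · obtain ⟨t, ht, rfl⟩ := h
      have hs : ∀ f : I → ℝ,
          ∑ u ∈ J, (if jumpIndex n u = jumpIndex n t then f u else 0) = f t := by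
        intro f
        rw [Finset.sum_eq_single_of_mem t ht fun u hu hut =>
          if_neg fun h => hut (hinj hu ht h), if_pos rfl]
      rw [hs, hs fun u => z (jumpIndex n u) - n * x u, truncAbove,
        if_neg ((hx t ht).trans_lt (hJ t ht).1).not_ge]
      ring
    · push Not at h
      rw [Finset.sum_eq_zero fun t ht => if_neg (h t ht),
        Finset.sum_eq_zero fun t ht => if_neg (h t ht), truncAbove, if_pos (hz j hjn h)]
      ring
  rw [Finset.sum_congr rfl hj, Finset.sum_add_distrib]
  refine (abs_add_le _ _).trans ?_
  rw [mul_add]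
  refine add_le_add (hsum k hk) ?_
  rw [Finset.sum_comm]
  refine (Finset.abs_sum_le_sum_abs _ _).trans ?_
  have hle : ∀ t ∈ J, |∑ j ∈ Finset.range k,
      (if jumpIndex n t = j then z (jumpIndex n t) - n * x t else 0)| ≤ n * η := by
    intro t ht
    rw [Finset.sum_ite_eq]
    split_ifs
    · have := hJ t ht
      rw [abs_of_nonneg (by linarith [this.1])]
      linarith [this.2]
    · simpa using by positivity
  refine (Finset.sum_le_card_nsmul _ _ _ hle).trans_eq ?_
  rw [nsmul_eq_mul]
  ring

section Walk

variable {Ω : Type*} [MeasurableSpace Ω] {P : Measure Ω} {d : ℕ} {Z : Fin d → ℕ → Ω → ℝ}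

theorem le_real_jumps [IsProbabilityMeasure P]
    (hindep : iIndepFun (fun p : Fin d × ℕ => Z p.1 p.2) P)
    (hZ : ∀ i j, Measurable (Z i j)) (hident : ∀ i j, IdentDistrib (Z i j) (Z i 0) P P)
    {n : ℕ} (hn : 0 < n) (J : Fin d → Finset I) (hinj : ∀ i, InjOn (jumpIndex n) (J i))
    {s : Fin d → I → Set ℝ} (hs : ∀ i t, MeasurableSet (s i t)) {b : ℝ}
    (hb : ∀ i, n * (P.map (Z i 0)).real (Ioi b) ≤ 1 / 2) :
    (1 / 2 : ℝ) ^ d * ∏ i, ∏ t ∈ J i, (P.map (Z i 0)).real (s i t) ≤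
      P.real {ω | ∀ i, (∀ t ∈ J i, Z i (jumpIndex n t) ω ∈ s i t) ∧
        ∀ j < n, (∀ t ∈ J i, jumpIndex n t ≠ j) → Z i j ω ≤ b} := by
  classical
  have hprob : ∀ i, IsProbabilityMeasure (P.map (Z i 0)) := fun i =>
    Measure.isProbabilityMeasure_map (hZ i 0).aemeasurable
  set A : Fin d → Finset ℕ := fun i => (J i).image (jumpIndex n)
  -- By injectivity of `jumpIndex n` on `J i`, the intersection has a single member; this form
  -- avoids inverting `jumpIndex`.
  set S : Fin d → ℕ → Set ℝ := fun i j =>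
    if j ∈ A i then ⋂ t ∈ (J i).filter (jumpIndex n · = j), s i t else Iic b
  have hS : ∀ i j, MeasurableSet (S i j) := by
    intro i j
    simp only [S]
    split_ifs
    · exact Finset.measurableSet_biInter _ fun t _ => hs i t
    · exact measurableSet_Iic
  have hSJ : ∀ i, ∀ t ∈ J i, S i (jumpIndex n t) = s i t := by
    intro i t ht
    have h1 : jumpIndex n t ∈ A i := Finset.mem_image_of_mem _ ht
    have h2 : (J i).filter (jumpIndex n · = jumpIndex n t) = {t} := by
      ext u
      simp only [Finset.mem_filter, Finset.mem_singleton]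
      exact ⟨fun h => hinj i h.1 ht h.2, by rintro rfl; exact ⟨ht, rfl⟩⟩
    simp only [S]
    rw [if_pos h1, h2]
    simp
  have hAsub : ∀ i, A i ⊆ Finset.range n := fun i j hj => by
    obtain ⟨t, -, rfl⟩ := Finset.mem_image.1 hj
    exact Finset.mem_range.2 (jumpIndex_lt hn t)
  have hsub : {ω | ∀ i, ∀ j ∈ Finset.range n, Z i j ω ∈ S i j} ⊆
      {ω | ∀ i, (∀ t ∈ J i, Z i (jumpIndex n t) ω ∈ s i t) ∧
        ∀ j < n, (∀ t ∈ J i, jumpIndex n t ≠ j) → Z i j ω ≤ b} := by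
    intro ω hω i
    refine ⟨fun t ht => ?_, fun j hj hne => ?_⟩
    · rw [← hSJ i t ht]
      exact hω i _ (hAsub i (Finset.mem_image_of_mem _ ht))
    · have h1 : Z i j ω ∈ S i j := hω i j (Finset.mem_range.2 hj)
      have h2 : j ∉ A i := fun h => by
        obtain ⟨t, ht, h⟩ := Finset.mem_image.1 h
        exact hne t ht h
      simp only [S, if_neg h2] at h1
      exact h1
  refine le_trans ?_ (measureReal_mono hsub)
  rw [real_iInter_preimage_eq_prod hindep hZ hident _ hS]
  have hd : (1 / 2 : ℝ) ^ d = ∏ _i : Fin d, (1 / 2 : ℝ) := by simp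
  rw [hd, ← Finset.prod_mul_distrib]
  refine Finset.prod_le_prod (fun i _ => by positivity) fun i _ => ?_
  rw [← Finset.prod_sdiff (hAsub i), Finset.prod_image (hinj i)]
  have h1 : ∏ t ∈ J i, (P.map (Z i 0)).real (S i (jumpIndex n t)) =
      ∏ t ∈ J i, (P.map (Z i 0)).real (s i t) :=
    Finset.prod_congr rfl fun t ht => by rw [hSJ i t ht]
  rw [h1]
  refine mul_le_mul_of_nonneg_right ?_ (by positivity)
  set q := (P.map (Z i 0)).real (Ioi b)
  have hq : (P.map (Z i 0)).real (Iic b) = 1 - q := by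
    rw [← compl_Ioi, probReal_compl_eq_one_sub measurableSet_Ioi]
  have hq0 : 0 ≤ q := measureReal_nonneg
  have hq1 : q ≤ 1 := measureReal_le_one
  have h2 : ∏ j ∈ Finset.range n \ A i, (P.map (Z i 0)).real (S i j) =
      (1 - q) ^ (Finset.range n \ A i).card := by
    rw [← Finset.prod_const]
    refine Finset.prod_congr rfl fun j hj => ?_
    simp only [S]
    rw [if_neg (Finset.mem_sdiff.1 hj).2, hq]
  rw [h2]
  have h3 : (1 - q) ^ n ≤ (1 - q) ^ (Finset.range n \ A i).card :=
    pow_le_pow_of_le_one (by linarith) (by linarith)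
      ((Finset.card_le_card Finset.sdiff_subset).trans_eq (Finset.card_range n))
  -- Bernoulli: `(1 - q) ^ n ≥ 1 - n * q ≥ 1 / 2`, so keeping the other increments small costs a
  -- factor `1 / 2` per coordinate.
  have h4 := one_add_mul_le_pow (show -2 ≤ -q by linarith) n
  rw [← sub_eq_add_neg] at h4
  linarith [hb i]

theorem eventually_exp_le_scaledWalk_mem [IsProbabilityMeasure P] {γ : ℝ} (hγ : 1 < γ)
    {lam : Fin d → ℝ} (hlam : ∀ i, 0 < lam i) (hZ : ∀ i j, Measurable (Z i j))
    (hindep : iIndepFun (fun p : Fin d × ℕ => Z p.1 p.2) P)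
    (hident : ∀ i j, IdentDistrib (Z i j) (Z i 0) P P)
    (htail : ∀ i, IsLognormalType (P.map (Z i 0)) γ (lam i)) {G : Set (SkorokhodProd d)}
    (hG : IsOpen G) {ξ : SkorokhodProd d} (hξ : ξ ∈ G) {M : ℝ}
    (hM : multiRate lam ξ < ENNReal.ofReal M) :
    ∀ᶠ n : ℕ in atTop,
      Real.exp (-M * Real.log n ^ γ) ≤ P.real (scaledWalk P Z n ⁻¹' G) := by
  classical
  have hγ0 : 0 < γ := by linarith
  have hprob : ∀ i, IsProbabilityMeasure (P.map (Z i 0)) := fun i =>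
    Measure.isProbabilityMeasure_map (hZ i 0).aemeasurable
  have hmem : ∀ i, ξ i ∈ tildeFin := by
    by_contra h
    rw [multiRate, if_neg h] at hM
    exact not_top_lt hM
  choose hmono hpure h0 hfin using fun i => mem_tildeFin.1 (hmem i)
  set J : Fin d → Finset I := fun i => (hfin i).toFinset
  set x : Fin d → I → ℝ := fun i t => ξ i t - (ξ i).leftLimit t
  have hx : ∀ i, ∀ t ∈ J i, 0 < x i t := fun i t ht =>
    sub_pos.2 (leftLimit_lt_of_mem_jumpTimes (hmono i) (h0 i) ((hfin i).mem_toFinset.1 ht))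
  have hJ0 : ∀ i, 0 ∉ J i := fun i h =>
    zero_notMem_jumpTimes (h0 i) ((hfin i).mem_toFinset.1 h)
  set R : ℝ := ∑ i, (J i).card * lam i
  have hR : R < M := by
    rw [multiRate, if_pos hmem] at hM
    have : ∑ i, ENNReal.ofReal (lam i) * (((ξ i).jumpTimes.encard : ℕ∞) : ℝ≥0∞) =
        ENNReal.ofReal R := by
      rw [ENNReal.ofReal_sum_of_nonneg fun i _ => mul_nonneg (Nat.cast_nonneg _) (hlam i).le]
      refine Finset.sum_congr rfl fun i _ => ?_
      rw [mul_comm, (hfin i).encard_eq_coe_toFinset_card, ENNReal.ofReal_mul (Nat.cast_nonneg _),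
        ENNReal.ofReal_natCast, ENat.toENNReal_coe]
    rw [this] at hM
    exact ((ENNReal.ofReal_lt_ofReal_iff_of_nonneg (Finset.sum_nonneg fun i _ =>
      mul_nonneg (Nat.cast_nonneg _) (hlam i).le)).1 hM)
  obtain ⟨e₀, he₀, hball⟩ := EMetric.isOpen_iff.1 hG ξ hξ
  obtain ⟨e, he, hee⟩ : ∃ e : ℝ, 0 < e ∧ ENNReal.ofReal e ≤ e₀ := by
    obtain ⟨e, -, h1, h2⟩ := ENNReal.lt_iff_exists_real_btwn.1 he₀
    exact ⟨e, ENNReal.ofReal_pos.1 h1, h2.le⟩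
  -- Three errors per coordinate: truncated sums, overshoots and time discretization. The factor `d
  -- + 1` makes the final inequality strict.
  obtain ⟨e', he', hee'⟩ : ∃ e' : ℝ, 0 < e' ∧ (d + 1) * (3 * e') = e :=
    ⟨e / (3 * (d + 1)), by positivity, by field_simp⟩
  obtain ⟨N, hN⟩ : ∃ N : ℕ, N = ∑ i, (J i).card := ⟨_, rfl⟩
  obtain ⟨η, hη, hηN⟩ : ∃ η : ℝ, 0 < η ∧ (N + 1) * η = e' :=
    ⟨e' / (N + 1), by positivity, by field_simp⟩
  have hJη : ∀ i, (J i).card * η ≤ e' := by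
    intro i
    have : (J i).card ≤ N :=
      hN ▸ Finset.single_le_sum (f := fun i => (J i).card) (fun _ _ => Nat.zero_le _)
        (Finset.mem_univ i)
    have h2 : ((J i).card : ℝ) ≤ N + 1 := by exact_mod_cast this.trans (Nat.le_succ _)
    calc (J i).card * η ≤ (N + 1) * η := by gcongr
      _ = e' := hηN
  -- Half of the gap `M - R` pays for the loss `κ` at each of the `N` jumps; the other half absorbs
  -- the constant `2 ^ (d + 1)`.
  obtain ⟨κ, hκ, hNκ⟩ : ∃ κ : ℝ, 0 < κ ∧ N * κ ≤ (M - R) / 2 := by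
    have hMR := sub_pos.2 hR
    refine ⟨(M - R) / (2 * (N + 1)), by positivity, ?_⟩
    rw [mul_div_assoc', div_le_div_iff₀ (by positivity) two_pos]
    nlinarith
  have hjump : ∀ᶠ n : ℕ in atTop, ∀ i, ∀ t ∈ J i, Real.exp (-(lam i + κ) * Real.log n ^ γ) ≤
      (P.map (Z i 0)).real (Ioc (n * x i t) (n * (x i t + η))) :=
    eventually_all.2 fun i => (eventually_all_finset _).2 fun t ht =>
      (htail i).eventually_exp_le_real_Ioc hγ0 (hx i t ht) hη (by linarith)
  have hlevel : ∀ᶠ n : ℕ in atTop, ∀ i, ∀ t ∈ J i, truncLevel n ≤ n * x i t :=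
    eventually_all.2 fun i => (eventually_all_finset _).2 fun t ht =>
      eventually_truncLevel_le (hx i t ht)
  have hsmall : ∀ᶠ n : ℕ in atTop, ∀ i,
      n * (P.map (Z i 0)).real (Ioi (truncLevel n)) ≤ 1 / 2 := by
    refine eventually_all.2 fun i => ?_
    have h := (DecaysAt.natCast hγ).mul (fun n => measureReal_nonneg)
      ((htail i).decaysAt_tail_rpow (a := 1 / 4) (by norm_num))
    have h' := h.tendsto_zero hγ0
      (by have := hlam i; positivity) fun n => by positivity
    filter_upwards [h'.eventually (gt_mem_nhds (show (0 : ℝ) < 1 / 2 by norm_num))]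
      with n hn using hn.le
  have hstep : ∀ᶠ n : ℕ in atTop, ∀ i, InjOn (jumpIndex n) (J i) ∧
      edist (scaledPath n fun j => n * ∑ t ∈ J i, if jumpIndex n t = j then x i t else 0) (ξ i) ≤
        ENNReal.ofReal e' :=
    eventually_all.2 fun i => eventually_edist_scaledPath_step_le
      (eq_sum_jumps (hpure i) (hfin i)) (hJ0 i) he'
  -- Any rate above `M` would do: the error must be at most `exp (-M * log n ^ γ)`, while the jump
  -- event has at least twice that probability.
  have herr : DecaysAt γ (M + 1) fun n => ∑ i, P.real (truncSumLarge P (Z i) e' n) :=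
    DecaysAt.sum hγ0 Finset.univ fun i _ => decaysAt_truncSumLarge hγ (hlam i) (hZ i)
      (hindep.precomp (g := fun j : ℕ => (i, j)) fun a b h => (Prod.mk.inj h).2)
      (hident i) (htail i) he' _
  have hconst : Tendsto (fun n : ℕ => (M - R) / 2 * Real.log n ^ γ) atTop atTop :=
    (tendsto_log_rpow_atTop hγ0).const_mul_atTop (half_pos (sub_pos.2 hR))
  filter_upwards [hjump, hlevel, hsmall, hstep, herr M (by linarith),
    hconst.eventually_ge_atTop (Real.log (2 ^ (d + 1))), eventually_gt_atTop 0,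
    (tendsto_log_rpow_atTop hγ0).eventually_ge_atTop 0] with n e1 e2 e3 e4 e5 e6 hn hL
  set L := Real.log n ^ γ
  set B := {ω | ∀ i, (∀ t ∈ J i, Z i (jumpIndex n t) ω ∈ Ioc (n * x i t) (n * (x i t + η))) ∧
    ∀ j < n, (∀ t ∈ J i, jumpIndex n t ≠ j) → Z i j ω ≤ truncLevel n}
  have hB : (1 / 2 : ℝ) ^ d * ∏ i, ∏ t ∈ J i,
      (P.map (Z i 0)).real (Ioc (n * x i t) (n * (x i t + η))) ≤ P.real B :=
    le_real_jumps hindep hZ hident hn J (fun i => (e4 i).1)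
      (s := fun i t => Ioc (n * x i t) (n * (x i t + η))) (fun _ _ => measurableSet_Ioc) e3
  have hprod : Real.exp (-((R + M) / 2) * L) ≤ ∏ i, ∏ t ∈ J i,
      (P.map (Z i 0)).real (Ioc (n * x i t) (n * (x i t + η))) := by
    calc Real.exp (-((R + M) / 2) * L) ≤ Real.exp (-(R + N * κ) * L) := by
          rw [Real.exp_le_exp]
          refine mul_le_mul_of_nonneg_right ?_ hL
          linarith
      _ = ∏ i, ∏ _t ∈ J i, Real.exp (-(lam i + κ) * L) := by
          simp only [Finset.prod_const, ← Real.exp_nat_mul]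
          rw [← Real.exp_sum]
          congr 1
          simp only [R, hN]
          push_cast
          rw [Finset.sum_mul, ← Finset.sum_add_distrib, ← Finset.sum_neg_distrib, Finset.sum_mul]
          exact Finset.sum_congr rfl fun i _ => by ring
      _ ≤ _ := Finset.prod_le_prod (fun i _ => Finset.prod_nonneg fun t _ => (Real.exp_pos _).le)
          fun i _ => Finset.prod_le_prod (fun t _ => (Real.exp_pos _).le) (e1 i)
  have hsub : B ⊆ scaledWalk P Z n ⁻¹' G ∪
      ⋃ i ∈ (Finset.univ : Finset (Fin d)), truncSumLarge P (Z i) e' n := by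
    intro ω hω
    by_contra hnot
    simp only [mem_union, mem_iUnion, not_or, not_exists, Finset.mem_univ,
      mem_ofPred_eq, truncSumLarge, not_and, not_lt, forall_const] at hnot
    obtain ⟨n1, n2⟩ := hnot
    refine n1 (hball (lt_of_lt_of_le ?_ hee))
    have hd : ∀ i, edist (scaledWalk P Z n ω i) (ξ i) ≤ ENNReal.ofReal (3 * e') := by
      intro i
      have h1 := edist_scaledPath_step_le he'.le hη.le (e4 i).1 (e2 i) (n2 i)
        (hω i).1 (hω i).2
      refine (edist_triangle _ _ _).trans ((add_le_add h1 (e4 i).2).trans ?_)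
      rw [← ENNReal.ofReal_add (by positivity) he'.le]
      exact ENNReal.ofReal_le_ofReal (by linarith [hJη i])
    calc edist (scaledWalk P Z n ω) ξ ≤ ∑ _i : Fin d, ENNReal.ofReal (3 * e') :=
          Finset.sum_le_sum fun i _ => hd i
      _ = ENNReal.ofReal (d * (3 * e')) := by
          rw [Finset.sum_const, Finset.card_univ, Fintype.card_fin, nsmul_eq_mul,
            ENNReal.ofReal_mul (Nat.cast_nonneg _), ENNReal.ofReal_natCast]
      _ < ENNReal.ofReal e := by
          refine (ENNReal.ofReal_lt_ofReal_iff he).2 ?_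
          linarith
  have hle : P.real B ≤ P.real (scaledWalk P Z n ⁻¹' G) +
      ∑ i, P.real (truncSumLarge P (Z i) e' n) :=
    (measureReal_mono hsub (measure_ne_top _ _)).trans ((measureReal_union_le _ _).trans
      (add_le_add le_rfl (measureReal_biUnion_finset_le _ _)))
  have hfinal : 2 * Real.exp (-M * L) ≤ (1 / 2 : ℝ) ^ d * Real.exp (-((R + M) / 2) * L) := by
    have h1 : (2 : ℝ) ^ (d + 1) * Real.exp (-M * L) ≤ Real.exp (-((R + M) / 2) * L) := by
      rw [← Real.exp_log (show (0 : ℝ) < 2 ^ (d + 1) by positivity), ← Real.exp_add,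
        Real.exp_le_exp]
      linarith
    calc 2 * Real.exp (-M * L)
        = (1 / 2 : ℝ) ^ d * ((2 : ℝ) ^ (d + 1) * Real.exp (-M * L)) := by
          rw [pow_succ, one_div, inv_pow]
          field_simp
      _ ≤ _ := by gcongr
  have hB' := (mul_le_mul_of_nonneg_left hprod (by positivity : (0 : ℝ) ≤ (1 / 2) ^ d)).trans hB
  linarith

end Walk

/-! ### The extended large deviation principle -/

/-! ### From exponential estimates to bounds on the normalized logarithms. -/

section EReal

variable {γ : ℝ} {X : Type*} [MeasurableSpace X] {μ : ℕ → Measure X} {s : Set X}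

theorem limsup_log_div_le [∀ n, IsFiniteMeasure (μ n)] (hγ : 0 < γ) {M : ℝ}
    (h : DecaysAt γ M fun n => (μ n).real s) :
    limsup (fun n => ENNReal.log (μ n s) / ((Real.log n ^ γ : ℝ) : EReal)) atTop ≤
      ((-M : ℝ) : EReal) := by
  refine EReal.le_of_forall_lt_iff_le.1 fun a ha => ?_
  have ha' : -a < M := by have := EReal.coe_lt_coe_iff.1 ha; linarith
  refine limsup_le_of_le (by isBoundedDefault) ?_
  filter_upwards [h _ ha', (tendsto_log_rpow_atTop hγ).eventually_gt_atTop 0] with n h1 hL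
  rw [EReal.div_le_iff_le_mul (by exact_mod_cast hL) (EReal.coe_ne_top _), ← ofReal_measureReal]
  refine (ENNReal.log_monotone (ENNReal.ofReal_le_ofReal h1)).trans ?_
  rw [ENNReal.log_ofReal_of_pos (Real.exp_pos _), Real.log_exp, ← EReal.coe_mul]
  refine EReal.coe_le_coe_iff.2 (le_of_eq (by ring))

theorem le_liminf_log_div [∀ n, IsFiniteMeasure (μ n)] (hγ : 0 < γ) {M : ℝ}
    (h : ∀ᶠ n : ℕ in atTop, Real.exp (-M * Real.log n ^ γ) ≤ (μ n).real s) :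
    ((-M : ℝ) : EReal) ≤
      liminf (fun n => ENNReal.log (μ n s) / ((Real.log n ^ γ : ℝ) : EReal)) atTop := by
  refine le_liminf_of_le (by isBoundedDefault) ?_
  filter_upwards [h, (tendsto_log_rpow_atTop hγ).eventually_gt_atTop 0] with n h1 hL
  rw [EReal.le_div_iff_mul_le (by exact_mod_cast hL) (EReal.coe_ne_top _), ← ofReal_measureReal]
  refine le_trans ?_ (ENNReal.log_monotone (ENNReal.ofReal_le_ofReal h1))
  rw [ENNReal.log_ofReal_of_pos (Real.exp_pos _), Real.log_exp, ← EReal.coe_mul]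

end EReal

theorem mainTheorem7 {Ω : Type*} [MeasurableSpace Ω] (P : Measure Ω) [IsProbabilityMeasure P]
    (d : ℕ) (γ : ℝ) (hγ : 1 < γ) (lam : Fin d → ℝ) (hlam : ∀ i, 0 < lam i)
    (Z : Fin d → ℕ → Ω → ℝ) (hZ : ∀ i j, Measurable (Z i j))
    (hindep : iIndepFun (fun p : Fin d × ℕ => Z p.1 p.2) P)
    (hident : ∀ i j, IdentDistrib (Z i j) (Z i 0) P P)
    (htail : ∀ i, IsLognormalType (P.map (Z i 0)) γ (lam i)) :
    (∀ n, Measurable (scaledWalk P Z n)) ∧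
      ExtendedLDP (fun n => P.map (scaledWalk P Z n)) (fun n => Real.log n ^ γ)
        (multiRate lam) := by
  have hγ0 : 0 < γ := by linarith
  have hmeas := measurable_scaledWalk P hZ
  refine ⟨hmeas, lowerSemicontinuous_multiRate hlam, tendsto_log_rpow_atTop hγ0,
    fun G hG => ?_, fun F hF => ?_⟩
  · refine EReal.neg_le_of_neg_le (le_iInf₂ fun ξ hξ => ?_)
    -- It suffices to test real `M` above the rate of a single point of `G`; if that rate is `∞`
    -- there is no such `M`.
    refine EReal.le_of_forall_lt_iff_le.1 fun M hM => ?_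
    refine EReal.neg_le_of_neg_le ?_
    rw [← EReal.coe_neg]
    refine le_liminf_log_div hγ0 ?_
    have hM' : multiRate lam ξ < ENNReal.ofReal M := by
      have hM0 : (0 : EReal) ≤ M := (EReal.coe_ennreal_nonneg _).trans hM.le
      rw [← EReal.coe_ennreal_lt_coe_ennreal_iff, EReal.coe_ennreal_ofReal,
        max_eq_left (EReal.coe_nonneg.1 hM0)]
      exact hM
    filter_upwards [eventually_exp_le_scaledWalk_mem hγ hlam hZ hindep hident htail hG hξ hM']
      with n hn
    rwa [map_measureReal_apply (hmeas n) hG.measurableSet]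
  · refine EReal.le_neg_of_le_neg (iSup₂_le fun ε hε => ?_)
    -- With `ε` fixed, real `M` below the infimum over the fattening are tested. Such `M` may be
    -- negative, which is why `max M 0` appears below.
    refine EReal.ge_of_forall_gt_iff_ge.1 fun M hM => ?_
    refine EReal.le_neg_of_le_neg ?_
    rw [← EReal.coe_neg]
    refine limsup_log_div_le hγ0 ?_
    have hM' : ∀ ξ ∈ Metric.cthickening ε F, ENNReal.ofReal M ≤ multiRate lam ξ := by
      intro ξ hξ
      rw [← EReal.coe_ennreal_le_coe_ennreal_iff, EReal.coe_ennreal_ofReal,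
        EReal.coe_strictMono.monotone.map_max]
      exact max_le (hM.le.trans (iInf₂_le ξ hξ)) (EReal.coe_ennreal_nonneg _)
    refine (decaysAt_scaledWalk_mem hγ hlam hZ hindep hident htail hε hM').mono
      (Eventually.of_forall fun n => ?_)
    rw [map_measureReal_apply (hmeas n) hF.measurableSet]
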